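/- \textbf{Setting.} Let $p\colon P\to M$ be a smooth principal $G$-bundle (right action), $G$ a real Lie group with Lie algebra $\mathfrak g$, and let $c$ be a non-degenerate $\mathrm{Ad}$-invariant symmetric bilinear form on $\mathfrak g$. Fix a principal connection $A\colon TP\to VP$ (projection to the vertical bundle), with horizontal lift and horizontal projection both denoted by $A^\perp$, curvature $F(X,Y)=-A[A^\perp X,A^\perp Y]$ and induced connection $\nabla^A_Xr=[A^\perp X,r]$ on $\operatorname{ad}P=VP/G$, and a $3$-form $H\in\Omega^3(M)$. Brackets of invariant vector fields are always Lie brackets of vector fields on $P$. Let $E=TP/G\oplus T^*M$, with anchor $\pi(X+\xi)=pX$, pairing $$\langle X+\xi,Y+\eta\rangle=\tfrac12(i_{pX}\eta+i_{pY}\xi)+c(AX,AY)$$ and Dorfman bracket $$[X+\xi,Y+\eta]=[X,Y]+L_{pX}\eta-i_{pY}d\xi+i_{pY}i_{pX}H+2c(\nabla^A(AX),AY)+2c(F(X,\cdot),AY)-2c(F(Y,\cdot),AX).$$ (The identity $dH=c(F\wedge F)$, under which $E$ is a transitive Courant algebroid, is not needed.) Write $[[e_1,e_2]]=\frac12([e_1,e_2]-[e_2,e_1])$.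 The connection $A$ gives an identification $E\cong T\oplus\operatorname{ad}P\oplus T^*$, where $T=TM$, $T^*=T^*M$; let $\lambda\colon T\to E$, $\lambda(X)=A^\perp X$, be the canonical isotropic splitting and $\pi_Q\colon E\to TP/G$ the projection. A generalized connection on $E$ is an operator $(e,s)\mapsto D_es$ on $\Gamma(E)$, $C^\infty(M)$-linear in $e$, additive in $s$, with $D_e(fs)=fD_es+\pi(e)(f)s$ and $\pi(e)\langle s_1,s_2\rangle=\langle D_es_1,s_2\rangle+\langle s_1,D_es_2\rangle$. Its generalized torsion is $$T_D(e_1,e_2,e_3)=\langle D_{e_1}e_2-D_{e_2}e_1-[[e_1,e_2]],e_3\rangle+\tfrac12\big(\langle D_{e_3}e_1,e_2\rangle-\langle D_{e_3}e_2,e_1\rangle\big).$$ \textbf{Lemma.} Let $\nabla^T$ be a connection on $T$ with torsion $T_\nabla$, let $\nabla^E=\nabla^T\oplus\nabla^A\oplus\nabla^{T^*}$ with $\nabla^{T^*}$ dual to $\nabla^T$, let $\chi\in\Gamma(E^*\otimes\mathfrak o(E))$, and let $D$ be the generalized connection $D_es=\nabla^E_{\pi(e)}s+\chi_es$. Then $$T_D=-\tfrac12\pi^*H+\pi_Q^*(CS(A))+\Sigma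 T_\nabla+\Sigma\chi,$$ where, for invariant vector fields $X,Y,Z$ on $P$, $$CS(A)(X,Y,Z)=-c(AX,[AY,AZ])+c(F(X,Y),AZ)-c(F(X,Z),AY)+c(F(Y,Z),AX),$$ and $$\Sigma T_\nabla(e_1,e_2,e_3)=\langle\lambda(T_\nabla(\pi e_1,\pi e_2)),e_3\rangle-\langle\lambda(T_\nabla(\pi e_1,\pi e_3)),e_2\rangle+\langle\lambda(T_\nabla(\pi e_2,\pi e_3)),e_1\rangle,$$ $$\Sigma\chi(e_1,e_2,e_3)=\langle\chi_{e_1}e_2,e_3\rangle-\langle\chi_{e_2}e_1,e_3\rangle+\langle\chi_{e_3}e_1,e_2\rangle.$$ -/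

import Mathlib

open Bundle VectorField
open scoped Manifold ContDiff

noncomputable section

namespace HeteroticCourant

/-! ### Vector fields and differential forms -/

section Fields

variable (E M : Type*) [NormedAddCommGroup E] [NormedSpace ℝ E]
  [TopologicalSpace M] [ChartedSpace E M]

/-- Not necessarily smooth vector fields. -/
abbrev VField := Π x : M, TangentSpace 𝓘(ℝ, E) x

/-- Not necessarily smooth 1-forms. -/
abbrev OneForm := Π x : M, TangentSpace 𝓘(ℝ, E) x →L[ℝ] ℝ

variable {E M}

/-- Smoothness of a vector field, as a section of the tangent bundle. -/
def SmoothField [IsManifold 𝓘(ℝ, E) ∞ M] (X : VField E M) : Prop :=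
  ContMDiff 𝓘(ℝ, E) 𝓘(ℝ, E).tangent ∞ (fun x => (⟨x, X x⟩ : TangentBundle 𝓘(ℝ, E) M))

/-- Smoothness of an `F`-valued 1-form, as a section of the bundle of homomorphisms from the
tangent bundle to the trivial bundle with fibre `F`. -/
def SmoothForm [IsManifold 𝓘(ℝ, E) ∞ M] {F : Type*} [NormedAddCommGroup F] [NormedSpace ℝ F]
    (ξ : Π x : M, TangentSpace 𝓘(ℝ, E) x →L[ℝ] F) : Prop :=
  ContMDiff 𝓘(ℝ, E) (𝓘(ℝ, E).prod 𝓘(ℝ, E →L[ℝ] F)) ∞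
    (fun x => (TotalSpace.mk x (ξ x) : TotalSpace (E →L[ℝ] F)
      (fun x : M => TangentSpace 𝓘(ℝ, E) x →L[ℝ] Bundle.Trivial M F x)))

/-- The derivative `X(f)` of a function `f` along a vector field `X`. -/
def dirDeriv (X : VField E M) (f : M → ℝ) (x : M) : ℝ := mvfderiv 𝓘(ℝ, E) f x (X x)

/-- The Lie bracket of vector fields. -/
abbrev lie (X Y : VField E M) : VField E M := mlieBracket 𝓘(ℝ, E) X Y

/-- `(L_X η)(Z) = X(η(Z)) - η([X, Z])`. -/
def lieDerivForm (X : VField E M) (η : OneForm E M) (Z : VField E M) (x : M) : ℝ :=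
  dirDeriv X (fun y => η y (Z y)) x - η x (lie X Z x)

/-- `(dξ)(Y, Z) = Y(ξ(Z)) - Z(ξ(Y)) - ξ([Y, Z])`. -/
def dForm (ξ : OneForm E M) (Y Z : VField E M) (x : M) : ℝ :=
  dirDeriv Y (fun y => ξ y (Z y)) x - dirDeriv Z (fun y => ξ y (Y y)) x - ξ x (lie Y Z x)

open Classical in
/-- The 1-form `ξ` given by its values `φ Z x = ξ_x(Z_x)` on vector fields `Z`: it is well-defined
where `φ` is tensorial, and is set to be zero elsewhere. -/
def formOf [FiniteDimensional ℝ E] [IsManifold 𝓘(ℝ, E) ∞ M] (φ : VField E M → M → ℝ) :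
    OneForm E M := fun x =>
  if h : TensorialAt 𝓘(ℝ, E) E (fun Z => φ Z x) x then
    TensorialAt.mkHom (fun Z => φ Z x) x h
  else 0

/-- Smooth 3-forms. -/
structure ThreeForm (E M : Type*) [NormedAddCommGroup E] [NormedSpace ℝ E]
    [TopologicalSpace M] [ChartedSpace E M] [IsManifold 𝓘(ℝ, E) ∞ M] where
  /-- the alternating form at each point -/
  toFun : Π x : M, TangentSpace 𝓘(ℝ, E) x [⋀^Fin 3]→L[ℝ] ℝ
  smooth : ∀ X Y Z : VField E M, SmoothField X → SmoothField Y → SmoothField Z →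
    ContMDiff 𝓘(ℝ, E) 𝓘(ℝ) ∞ (fun x => toFun x ![X x, Y x, Z x])

/-- The connection on the cotangent bundle dual to a connection `nab` on the tangent bundle:
`(∇_X ξ)(Z) = X(ξ(Z)) - ξ(∇_X Z)`. -/
def dualConn [FiniteDimensional ℝ E] [IsManifold 𝓘(ℝ, E) ∞ M]
    (nab : CovariantDerivative 𝓘(ℝ, E) E (TangentSpace 𝓘(ℝ, E) : M → Type _))
    (X : VField E M) (ξ : OneForm E M) : OneForm E M :=
  formOf fun Z x => dirDeriv X (fun y => ξ y (Z y)) x - ξ x (nab Z x (X x))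

end Fields

/-! ### Principal bundles and principal connections -/

section LieGroups

variable (EG G : Type*) [NormedAddCommGroup EG] [NormedSpace ℝ EG]
  [TopologicalSpace G] [ChartedSpace EG G] [Group G]

/-- The Lie algebra of `G`. -/
abbrev LieAlg := GroupLieAlgebra 𝓘(ℝ, EG) G

variable {EG G}

/-- The adjoint action of `G` on its Lie algebra. -/
def Ad (g : G) (z : LieAlg EG G) : LieAlg EG G :=
  mfderiv 𝓘(ℝ, EG) 𝓘(ℝ, EG) (fun h : G => g * h * g⁻¹) 1 z

/-- `c` is a non-degenerate symmetric bilinear form on the Lie algebra of `G`, invariant under the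
adjoint action. -/
structure IsInvariantMetric (c : LinearMap.BilinForm ℝ (LieAlg EG G)) : Prop where
  symm : ∀ z w, c z w = c w z
  nondegenerate : ∀ z, (∀ w, c z w = 0) → z = 0
  invariant : ∀ (g : G) (z w : LieAlg EG G), c (Ad g z) (Ad g w) = c z w

end LieGroups

variable {EM EG EP M G P : Type*}
  [NormedAddCommGroup EM] [NormedSpace ℝ EM] [FiniteDimensional ℝ EM]
  [NormedAddCommGroup EG] [NormedSpace ℝ EG] [FiniteDimensional ℝ EG]
  [NormedAddCommGroup EP] [NormedSpace ℝ EP] [FiniteDimensional ℝ EP]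
  [TopologicalSpace M] [ChartedSpace EM M] [IsManifold 𝓘(ℝ, EM) ∞ M]
  [TopologicalSpace G] [ChartedSpace EG G] [Group G] [LieGroup 𝓘(ℝ, EG) ∞ G]
  [TopologicalSpace P] [ChartedSpace EP P] [IsManifold 𝓘(ℝ, EP) ∞ P]
  [MulAction Gᵐᵒᵖ P]

/-- The right action `(p, g) ↦ p g` of `G` on `P`. -/
abbrev ract (p : P) (g : G) : P := MulOpposite.op g • p

variable (EM EG EP M G P) in
/-- Smooth principal `G`-bundles `P` over `M`, for a given right action of `G` on `P`: around each
point of `M` there is a smooth `G`-equivariant trivialization of the projection. -/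
structure SmoothPrincipalBundle where
  /-- the projection -/
  proj : P → M
  contMDiff_act : ContMDiff (𝓘(ℝ, EP).prod 𝓘(ℝ, EG)) 𝓘(ℝ, EP) ∞
    (fun q : P × G => ract q.1 q.2)
  contMDiff_proj : ContMDiff 𝓘(ℝ, EP) 𝓘(ℝ, EM) ∞ proj
  proj_act : ∀ (p : P) (g : G), proj (ract p g) = proj p
  locallyTrivial : ∀ x : M, ∃ t : Trivialization G proj, x ∈ t.baseSet ∧
    ContMDiffOn 𝓘(ℝ, EP) (𝓘(ℝ, EM).prod 𝓘(ℝ, EG)) ∞ t.toOpenPartialHomeomorph t.source ∧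
    ContMDiffOn (𝓘(ℝ, EM).prod 𝓘(ℝ, EG)) 𝓘(ℝ, EP) ∞ t.toOpenPartialHomeomorph.symm t.target ∧
    ∀ p ∈ t.source, ∀ g : G,
      (t.toOpenPartialHomeomorph (ract p g)).2 = (t.toOpenPartialHomeomorph p).2 * g

/-- The fundamental vector field `Y_z` of `z` in the Lie algebra: `Y_z(p) = d/dt (p exp(tz))` at
`t = 0`. -/
def fundField (z : LieAlg EG G) : VField EP P := fun p =>
  mfderiv 𝓘(ℝ, EG) 𝓘(ℝ, EP) (fun g : G => ract p g) 1 z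

namespace SmoothPrincipalBundle

set_option linter.unusedSectionVars false in
theorem surjective (B : SmoothPrincipalBundle EM EG EP M G P) : Function.Surjective B.proj := by
  intro x
  obtain ⟨t, hx, -⟩ := B.locallyTrivial x
  exact ⟨t.toOpenPartialHomeomorph.symm (x, 1), t.proj_symm_apply (t.mem_target.2 hx)⟩

/-- A point of the fibre over `x`. -/
def point (B : SmoothPrincipalBundle EM EG EP M G P) (x : M) : P := Function.surjInv B.surjective x

/-- A vector field `X` on `P` is a section of `TP/G` if it is smooth and `G`-invariant. -/
def IsInvariantField (_B : SmoothPrincipalBundle EM EG EP M G P) (X : VField EP P) : Prop :=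
  SmoothField X ∧ ∀ (p : P) (g : G),
    X (ract p g) = mfderiv 𝓘(ℝ, EP) 𝓘(ℝ, EP) (fun q : P => ract q g) p (X p)

/-- The vector field `pX` on `M` induced by an invariant vector field `X` on `P`. -/
def push (B : SmoothPrincipalBundle EM EG EP M G P) (X : VField EP P) : VField EM M := fun x =>
  mfderiv 𝓘(ℝ, EP) 𝓘(ℝ, EM) B.proj (B.point x) (X (B.point x))

/-- Principal connections on `P`, given by their connection 1-form. -/
structure Connection (_B : SmoothPrincipalBundle EM EG EP M G P) where
  /-- the connection form, with values in the Lie algebra -/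
  form : Π p : P, TangentSpace 𝓘(ℝ, EP) p →L[ℝ] LieAlg EG G
  smooth : SmoothForm (F := EG) form
  form_fundField : ∀ (z : LieAlg EG G) (p : P), form p (fundField z p) = z
  equivariant : ∀ (p : P) (g : G) (v : TangentSpace 𝓘(ℝ, EP) p),
    form (ract p g) (mfderiv 𝓘(ℝ, EP) 𝓘(ℝ, EP) (fun q : P => ract q g) p v) = Ad g⁻¹ (form p v)

end SmoothPrincipalBundle

namespace SmoothPrincipalBundle.Connection

variable {B : SmoothPrincipalBundle EM EG EP M G P} (A : B.Connection)

/-- The connection as projection `A : TP → VP` to the vertical bundle; `A.vert X` is `A X`. -/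
def vert (X : VField EP P) : VField EP P := fun p => fundField (A.form p (X p)) p

/-- The horizontal part `A^⊥ X = X - A X`. -/
def hor (X : VField EP P) : VField EP P := fun p => X p - A.vert X p

/-- The horizontal lift `A^⊥ X` to `P` of a vector field `X` on `M`: the vector field with
`dp(A^⊥ X) = X` and `A(A^⊥ X) = 0`. -/
def lift (X : VField EM M) : VField EP P := fun p =>
  ((mfderiv 𝓘(ℝ, EP) 𝓘(ℝ, EM) B.proj p).prod (A.form p)).inverse (X (B.proj p), 0)

/-- The curvature `F(X, Y) = -A[A^⊥ X, A^⊥ Y]`, with values in `VP`. -/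
def curv (X Y : VField EP P) : VField EP P := -A.vert (lie (A.hor X) (A.hor Y))

/-- The connection `∇^A_X r = [A^⊥ X, r]` on `ad P = VP/G`, for a vector field `X` on `M` and an
invariant vertical vector field `r` on `P`. -/
def adConn (X : VField EM M) (r : VField EP P) : VField EP P := lie (A.lift X) r

end SmoothPrincipalBundle.Connection

/-! ### The Courant algebroid `E = TP/G ⊕ T^*M` -/

variable (EM EG EP M G P) in
/-- The data of the transitive Courant algebroid in the presentation determined by the
connection `A`. -/
structure CourantData where
  /-- the principal bundle -/
  B : SmoothPrincipalBundle EM EG EP M G P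
  /-- the bilinear form on the Lie algebra -/
  c : LinearMap.BilinForm ℝ (LieAlg EG G)
  metric : IsInvariantMetric c
  /-- the principal connection -/
  A : B.Connection
  /-- the 3-form on the base -/
  H : ThreeForm EM M

variable (EM EP M P) in
/-- Pairs `X + ξ` of a (not necessarily smooth or invariant) vector field `X` on `P` and a
(not necessarily smooth) 1-form `ξ` on `M`. -/
abbrev PreSection := VField EP P × OneForm EM M

namespace CourantData

variable (𝓔 : CourantData EM EG EP M G P)

/-- Smooth sections of `E = TP/G ⊕ T^*M`: pairs `X + ξ` of an invariant smooth vector field on `P`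
and a smooth 1-form on `M`. -/
def IsSection (e : PreSection EM EP M P) : Prop :=
  𝓔.B.IsInvariantField e.1 ∧ SmoothForm e.2

/-- Multiplication of a section by a function on `M`. -/
def fsmul (f : M → ℝ) (e : PreSection EM EP M P) : PreSection EM EP M P :=
  (fun p => f (𝓔.B.proj p) • e.1 p, fun x => f x • e.2 x)

/-- The anchor `π(X + ξ) = pX`. -/
def anchor (e : PreSection EM EP M P) : VField EM M := 𝓔.B.push e.1

/-- The function `c(r, s)` on `M`, for invariant vertical vector fields `r` and `s` on `P`. The
connection form only serves to identify vertical vectors with elements of the Lie algebra. -/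
def cM (r s : VField EP P) (x : M) : ℝ :=
  𝓔.c (𝓔.A.form (𝓔.B.point x) (r (𝓔.B.point x))) (𝓔.A.form (𝓔.B.point x) (s (𝓔.B.point x)))

/-- `⟨X + ξ, Y + η⟩ = 1/2 (η(pX) + ξ(pY)) + c(A X, A Y)`. -/
def pairing (e₁ e₂ : PreSection EM EP M P) (x : M) : ℝ :=
  (1 / 2) * (e₂.2 x (𝓔.anchor e₁ x) + e₁.2 x (𝓔.anchor e₂ x))
    + 𝓔.cM (𝓔.A.vert e₁.1) (𝓔.A.vert e₂.1) x

/-- The Dorfman bracket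
`[X + ξ, Y + η] = [X, Y] + L_{pX} η - i_{pY} dξ + i_{pY} i_{pX} H`
`  + 2 c(∇^A(A X), A Y) + 2 c(F(X, ·), A Y) - 2 c(F(Y, ·), A X)`. -/
def dorfman (e₁ e₂ : PreSection EM EP M P) : PreSection EM EP M P :=
  (lie e₁.1 e₂.1,
   formOf fun Z x =>
    lieDerivForm (𝓔.anchor e₁) e₂.2 Z x - dForm e₁.2 (𝓔.anchor e₂) Z x
      + 𝓔.H.toFun x ![𝓔.anchor e₁ x, 𝓔.anchor e₂ x, Z x]
      + 2 * 𝓔.cM (𝓔.A.adConn Z (𝓔.A.vert e₁.1)) (𝓔.A.vert e₂.1) x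
      + 2 * 𝓔.cM (𝓔.A.curv e₁.1 (𝓔.A.lift Z)) (𝓔.A.vert e₂.1) x
      - 2 * 𝓔.cM (𝓔.A.curv e₂.1 (𝓔.A.lift Z)) (𝓔.A.vert e₁.1) x)

/-- The skew-symmetrization `[[e₁, e₂]] = 1/2 ([e₁, e₂] - [e₂, e₁])` of the Dorfman bracket. -/
def skewBracket (e₁ e₂ : PreSection EM EP M P) : PreSection EM EP M P :=
  (1 / 2 : ℝ) • (𝓔.dorfman e₁ e₂ - 𝓔.dorfman e₂ e₁)

/-- The Chern-Simons form on invariant vector fields: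
`CS(A)(X, Y, Z) = - c(A X, [A Y, A Z]) + c(F(X, Y), A Z) - c(F(X, Z), A Y) + c(F(Y, Z), A X)`,
with the Lie bracket of vector fields on `P`. -/
def CS (X Y Z : VField EP P) (x : M) : ℝ :=
  -𝓔.cM (𝓔.A.vert X) (lie (𝓔.A.vert Y) (𝓔.A.vert Z)) x
    + 𝓔.cM (𝓔.A.curv X Y) (𝓔.A.vert Z) x
    - 𝓔.cM (𝓔.A.curv X Z) (𝓔.A.vert Y) x
    + 𝓔.cM (𝓔.A.curv Y Z) (𝓔.A.vert X) x

/-! ### Generalized connections -/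

/-- Generalized connections on `E`, compatible with the pairing. -/
structure GenConnection where
  /-- `(e, s) ↦ D_e s` -/
  toFun : PreSection EM EP M P → PreSection EM EP M P → PreSection EM EP M P
  isSection : ∀ e s, 𝓔.IsSection e → 𝓔.IsSection s → 𝓔.IsSection (toFun e s)
  add_left : ∀ e e' s, 𝓔.IsSection e → 𝓔.IsSection e' → 𝓔.IsSection s →
    toFun (e + e') s = toFun e s + toFun e' s
  fsmul_left : ∀ (f : M → ℝ) e s, ContMDiff 𝓘(ℝ, EM) 𝓘(ℝ) ∞ f → 𝓔.IsSection e → 𝓔.IsSection s →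
    toFun (𝓔.fsmul f e) s = 𝓔.fsmul f (toFun e s)
  add_right : ∀ e s s', 𝓔.IsSection e → 𝓔.IsSection s → 𝓔.IsSection s' →
    toFun e (s + s') = toFun e s + toFun e s'
  leibniz : ∀ (f : M → ℝ) e s, ContMDiff 𝓘(ℝ, EM) 𝓘(ℝ) ∞ f → 𝓔.IsSection e → 𝓔.IsSection s →
    toFun e (𝓔.fsmul f s) = 𝓔.fsmul f (toFun e s) + 𝓔.fsmul (dirDeriv (𝓔.anchor e) f) s
  compatible : ∀ e s₁ s₂, 𝓔.IsSection e → 𝓔.IsSection s₁ → 𝓔.IsSection s₂ → ∀ x,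
    dirDeriv (𝓔.anchor e) (𝓔.pairing s₁ s₂) x
      = 𝓔.pairing (toFun e s₁) s₂ x + 𝓔.pairing s₁ (toFun e s₂) x

/-- Sections `χ` of `E^* ⊗ 𝔬(E)`, as `C^∞(M)`-bilinear maps `(e, s) ↦ χ_e s`. -/
structure OrthForm where
  /-- `(e, s) ↦ χ_e s` -/
  toFun : PreSection EM EP M P → PreSection EM EP M P → PreSection EM EP M P
  isSection : ∀ e s, 𝓔.IsSection e → 𝓔.IsSection s → 𝓔.IsSection (toFun e s)
  add_left : ∀ e e' s, 𝓔.IsSection e → 𝓔.IsSection e' → 𝓔.IsSection s →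
    toFun (e + e') s = toFun e s + toFun e' s
  fsmul_left : ∀ (f : M → ℝ) e s, ContMDiff 𝓘(ℝ, EM) 𝓘(ℝ) ∞ f → 𝓔.IsSection e → 𝓔.IsSection s →
    toFun (𝓔.fsmul f e) s = 𝓔.fsmul f (toFun e s)
  add_right : ∀ e s s', 𝓔.IsSection e → 𝓔.IsSection s → 𝓔.IsSection s' →
    toFun e (s + s') = toFun e s + toFun e s'
  fsmul_right : ∀ (f : M → ℝ) e s, ContMDiff 𝓘(ℝ, EM) 𝓘(ℝ) ∞ f → 𝓔.IsSection e → 𝓔.IsSection s →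
    toFun e (𝓔.fsmul f s) = 𝓔.fsmul f (toFun e s)
  skew : ∀ e s₁ s₂, 𝓔.IsSection e → 𝓔.IsSection s₁ → 𝓔.IsSection s₂ → ∀ x,
    𝓔.pairing (toFun e s₁) s₂ x + 𝓔.pairing s₁ (toFun e s₂) x = 0

/-- The connection `∇^E = ∇^T ⊕ ∇^A ⊕ ∇^{T^*}` on `E ≅ T ⊕ ad P ⊕ T^*`: for `s = Y + η` and a vector
field `X` on `M`, `∇^E_X s = A^⊥(∇^T_X (pY)) + ∇^A_X (A Y) + ∇^{T^*}_X η`. -/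
def nablaE (nab : CovariantDerivative 𝓘(ℝ, EM) EM (TangentSpace 𝓘(ℝ, EM) : M → Type _))
    (X : VField EM M) (s : PreSection EM EP M P) : PreSection EM EP M P :=
  (𝓔.A.lift (fun x => nab (𝓔.anchor s) x (X x)) + 𝓔.A.adConn X (𝓔.A.vert s.1),
   dualConn nab X s.2)

variable {𝓔} in
/-- The generalized torsion
`T_D(e₁, e₂, e₃) = ⟨D_{e₁} e₂ - D_{e₂} e₁ - [[e₁, e₂]], e₃⟩`
`  + 1/2 (⟨D_{e₃} e₁, e₂⟩ - ⟨D_{e₃} e₂, e₁⟩)`. -/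
def GenConnection.torsion (D : 𝓔.GenConnection) (e₁ e₂ e₃ : PreSection EM EP M P) (x : M) : ℝ :=
  𝓔.pairing (D.toFun e₁ e₂ - D.toFun e₂ e₁ - 𝓔.skewBracket e₁ e₂) e₃ x
    + (1 / 2) * (𝓔.pairing (D.toFun e₃ e₁) e₂ x - 𝓔.pairing (D.toFun e₃ e₂) e₁ x)

/-- The pull-back `π^*H`. -/
def pullH (e₁ e₂ e₃ : PreSection EM EP M P) (x : M) : ℝ :=
  𝓔.H.toFun x ![𝓔.anchor e₁ x, 𝓔.anchor e₂ x, 𝓔.anchor e₃ x]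

/-- The projection `π_Q : E → TP/G`, `X + ξ ↦ X`. -/
def piQ (e : PreSection EM EP M P) : VField EP P := e.1

/-- The pull-back `π_Q^* CS(A)`. -/
def pullCS (e₁ e₂ e₃ : PreSection EM EP M P) (x : M) : ℝ := 𝓔.CS (piQ e₁) (piQ e₂) (piQ e₃) x

/-- The canonical isotropic splitting `λ : T → E`, `X ↦ A^⊥ X`. -/
def splitting (X : VField EM M) : PreSection EM EP M P := (𝓔.A.lift X, 0)

/-- `π^*λ(T_∇)(e₁, e₂) = λ(T_∇(π e₁, π e₂))`, with `T_∇` the torsion of the connection on `T`. -/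
def pullTorsion (nab : CovariantDerivative 𝓘(ℝ, EM) EM (TangentSpace 𝓘(ℝ, EM) : M → Type _))
    (e₁ e₂ : PreSection EM EP M P) : PreSection EM EP M P :=
  𝓔.splitting fun x => nab.torsion x (𝓔.anchor e₁ x) (𝓔.anchor e₂ x)

/-- `ΣT_∇(e₁, e₂, e₃) = ⟨π^*λ(T_∇)(e₁, e₂), e₃⟩ - ⟨π^*λ(T_∇)(e₁, e₃), e₂⟩`
`  + ⟨π^*λ(T_∇)(e₂, e₃), e₁⟩`. -/
def sigmaTorsion (nab : CovariantDerivative 𝓘(ℝ, EM) EM (TangentSpace 𝓘(ℝ, EM) : M → Type _))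
    (e₁ e₂ e₃ : PreSection EM EP M P) (x : M) : ℝ :=
  𝓔.pairing (𝓔.pullTorsion nab e₁ e₂) e₃ x - 𝓔.pairing (𝓔.pullTorsion nab e₁ e₃) e₂ x
    + 𝓔.pairing (𝓔.pullTorsion nab e₂ e₃) e₁ x

variable {𝓔} in
/-- `Σχ(e₁, e₂, e₃) = ⟨χ_{e₁} e₂, e₃⟩ - ⟨χ_{e₂} e₁, e₃⟩ + ⟨χ_{e₃} e₁, e₂⟩`. -/
def OrthForm.sigma (χ : 𝓔.OrthForm) (e₁ e₂ e₃ : PreSection EM EP M P) (x : M) : ℝ :=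
  𝓔.pairing (χ.toFun e₁ e₂) e₃ x - 𝓔.pairing (χ.toFun e₂ e₁) e₃ x
    + 𝓔.pairing (χ.toFun e₃ e₁) e₂ x

end CourantData

end HeteroticCourant

end

/-! Pair every term with a third section and split each invariant field on `P` into its horizontal
and vertical parts. Each side then becomes a sum of four kinds of term: derivatives of functions
η(pX), terms in `nab` and in brackets on the base, values of `H`, and terms c(A[·,·], A·).
`pairing_nablaE` and `pairing_dorfman` record these expansions. In the torsion, the derivatives of
η(pX) cancel, and so do the mixed terms c(A[A^⊥X, AY], AZ), that is, the ∇^A terms. The base terms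
assemble into ΣT_∇, the form `H` survives with factor -1/2, and the horizontal brackets give the
curvature part of CS(A). Two genuine identities remain. Skewness of χ_{e₃} turns the half-difference
in the torsion into the last term of Σχ. The equality c([AX, AY], AZ) = c(AX, [AY, AZ]) of
`metric_form_lie_vert` gives the cubic term of CS(A). The analytic input is that Lie brackets are
natural under maps that are not local diffeomorphisms (`mfderiv_mlieBracket_of_related`). Applied to
the action P × G → P, it shows that invariant fields commute with fundamental ones. Hence A[h, AX]
is the derivative of the function A(X) along h for every invariant h (`form_lie_vert`). Applied to
the projection, it shows that brackets of invariant fields descend to `M`. With this, tensoriality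
of the 1-form part of the bracket and Ad-invariance in infinitesimal form are both statements about
derivatives of functions. -/

noncomputable section

set_option linter.unusedSectionVars false

namespace HeteroticCourant

/-! ### Related vector fields -/

section Related

open Set Filter Topology

/-- The Lie bracket of vector fields on normed spaces is natural under `C^2` maps. -/
lemma fderiv_lieBracket_of_related {E F : Type*} [NormedAddCommGroup E] [NormedSpace ℝ E]
    [NormedAddCommGroup F] [NormedSpace ℝ F] {f : E → F} {V W : E → E} {V' W' : F → F} {x : E}
    (hf : ContDiffAt ℝ 2 f x) (hV : DifferentiableAt ℝ V x) (hW : DifferentiableAt ℝ W x)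
    (hV' : DifferentiableAt ℝ V' (f x)) (hW' : DifferentiableAt ℝ W' (f x))
    (hVV' : ∀ᶠ y in 𝓝 x, fderiv ℝ f y (V y) = V' (f y))
    (hWW' : ∀ᶠ y in 𝓝 x, fderiv ℝ f y (W y) = W' (f y)) :
    fderiv ℝ f x (lieBracket ℝ V W x) = lieBracket ℝ V' W' (f x) := by
  have hf1 : DifferentiableAt ℝ f x := hf.differentiableAt (by simp)
  have hf2 : DifferentiableAt ℝ (fderiv ℝ f) x :=
    (hf.fderiv_right (m := 1) (by norm_num)).differentiableAt (by simp)
  -- Differentiate the relation Df(U) = U' ∘ f along `v`. In the difference for `V` and `W` the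
  -- second derivative of `f` drops out by symmetry.
  have key : ∀ {U : E → E} {U' : F → F}, DifferentiableAt ℝ U x → DifferentiableAt ℝ U' (f x) →
      (∀ᶠ y in 𝓝 x, fderiv ℝ f y (U y) = U' (f y)) → ∀ v,
      fderiv ℝ (fderiv ℝ f) x v (U x) + fderiv ℝ f x (fderiv ℝ U x v)
        = fderiv ℝ U' (f x) (fderiv ℝ f x v) := by
    intro U U' hU hU' h v
    have h1 := (hf2.hasFDerivAt.clm_apply hU.hasFDerivAt).congr_of_eventuallyEq
      (EventuallyEq.symm h)
    have h2 := hU'.hasFDerivAt.comp x hf1.hasFDerivAt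
    have := DFunLike.congr_fun (h1.unique h2) v
    simpa [add_comm] using this
  have hs : IsSymmSndFDerivAt ℝ f x := hf.isSymmSndFDerivAt (by simp)
  rw [lieBracket_eq, lieBracket_eq]
  simp only
  rw [map_sub, ← hVV'.self_of_nhds, ← hWW'.self_of_nhds, ← key hW hW' hWW', ← key hV hV' hVV',
    hs.eq (V x) (W x)]
  abel

variable {E H N E' H' N' : Type*}
  [NormedAddCommGroup E] [NormedSpace ℝ E] [CompleteSpace E]
  [TopologicalSpace H] {I : ModelWithCorners ℝ E H} [I.Boundaryless]
  [TopologicalSpace N] [ChartedSpace H N] [IsManifold I 2 N]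
  [NormedAddCommGroup E'] [NormedSpace ℝ E'] [CompleteSpace E']
  [TopologicalSpace H'] {I' : ModelWithCorners ℝ E' H'} [I'.Boundaryless]
  [TopologicalSpace N'] [ChartedSpace H' N'] [IsManifold I' 2 N']

/-- The vector field `V` in the chart `extChartAt I x`. -/
def chartField (I : ModelWithCorners ℝ E H) (x : N) (V : Π y : N, TangentSpace I y) : E → E :=
  mpullbackWithin 𝓘(ℝ, E) I (extChartAt I x).symm V (range I)

lemma differentiableAt_chartField {x : N} {V : Π y : N, TangentSpace I y}
    (hV : MDiffAt (T% V) x) : DifferentiableAt ℝ (chartField I x V) (extChartAt I x x) := by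
  rw [← mdifferentiableWithinAt_univ] at hV
  have := hV.differentiableWithinAt_mpullbackWithin_vectorField
  have hs : (extChartAt I x).symm ⁻¹' univ ∩ range I = univ := by simp [I.range_eq_univ]
  exact differentiableWithinAt_univ.1 (hs ▸ this)

omit [CompleteSpace E] [I.Boundaryless] in
lemma chartField_extChartAt {x y : N} (V : Π y : N, TangentSpace I y)
    (hy : y ∈ (extChartAt I x).source) :
    chartField I x V (extChartAt I x y) = mfderiv I 𝓘(ℝ, E) (extChartAt I x) y (V y) := by
  have : IsManifold I 1 N := .of_le (n := 2) (by norm_num)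
  have hy' := (extChartAt I x).map_source hy
  have h : chartField I x V (extChartAt I x y)
      = (mfderiv I 𝓘(ℝ, E) (extChartAt I x) ((extChartAt I x).symm (extChartAt I x y)) :
        TangentSpace I ((extChartAt I x).symm (extChartAt I x y)) →L[ℝ] E)
        (V ((extChartAt I x).symm (extChartAt I x y))) :=
    DFunLike.congr_fun (ContinuousLinearMap.inverse_eq
      (mfderivWithin_extChartAt_symm_comp_mfderiv_extChartAt hy')
      (mfderiv_extChartAt_comp_mfderivWithin_extChartAt_symm hy')) _
  rw [h, (extChartAt I x).left_inv hy]

-- `mlieBracket` is by definition the chart bracket pulled back by the derivative of the chart.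
-- Without boundary the domain of that bracket is the whole model space, so `lieBracketWithin` is
-- the ordinary bracket.
omit [CompleteSpace E] in
lemma mfderiv_extChartAt_mlieBracket {x : N} (V W : Π y : N, TangentSpace I y) :
    mfderiv I 𝓘(ℝ, E) (extChartAt I x) x (mlieBracket I V W x)
      = lieBracket ℝ (chartField I x V) (chartField I x W) (extChartAt I x x) := by
  have : IsManifold I 1 N := .of_le (n := 2) (by norm_num)
  have hs : (extChartAt I x).symm ⁻¹' univ ∩ range I = univ := by simp [I.range_eq_univ]
  have h : mlieBracket I V W x = (mfderiv I 𝓘(ℝ, E) (extChartAt I x) x).inverse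
      (lieBracketWithin (E := E) ℝ (chartField I x V) (chartField I x W)
        ((extChartAt I x).symm ⁻¹' univ ∩ range I) (extChartAt I x x)) := rfl
  rw [h, hs, lieBracketWithin_univ]
  exact (isInvertible_mfderiv_extChartAt (mem_extChartAt_source x)).self_apply_inverse _

/-- The Lie bracket of vector fields is natural under `C^2` maps. -/
lemma mfderiv_mlieBracket_of_related {f : N → N'} {V W : Π y : N, TangentSpace I y}
    {V' W' : Π y : N', TangentSpace I' y} {x : N} (hf : ContMDiffAt I I' 2 f x)
    (hV : MDiffAt (T% V) x) (hW : MDiffAt (T% W) x)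
    (hV' : MDiffAt (T% V') (f x)) (hW' : MDiffAt (T% W') (f x))
    (hVV' : ∀ᶠ y in 𝓝 x, mfderiv I I' f y (V y) = V' (f y))
    (hWW' : ∀ᶠ y in 𝓝 x, mfderiv I I' f y (W y) = W' (f y)) :
    mfderiv I I' f x (mlieBracket I V W x) = mlieBracket I' V' W' (f x) := by
  have : IsManifold I 1 N := .of_le (n := 2) (by norm_num)
  have : IsManifold I' 1 N' := .of_le (n := 2) (by norm_num)
  set φ := extChartAt I x
  set ψ := extChartAt I' (f x)
  -- The map `f` in charts at `x` and `f x`. The normed-space case applies to `g` once relatedness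
  -- is carried to the charts (`hrel`); only the chart derivatives, never that of `f`, need to be
  -- invertible.
  set g : E → E' := ψ ∘ f ∘ φ.symm
  have hg : ContDiffAt ℝ 2 g (φ x) := by
    have := (contMDiffAt_iff.1 hf).2
    rwa [I.range_eq_univ, contDiffWithinAt_univ] at this
  have hx : φ.symm (φ x) = x := extChartAt_to_inv x
  have hfe : ∀ᶠ y in 𝓝 x, MDifferentiableAt I I' f y ∧ y ∈ φ.source ∧ f y ∈ ψ.source := by
    filter_upwards [(contMDiffAt_iff_contMDiffAt_nhds (by simp)).1 hf, extChartAt_source_mem_nhds (I := I) x,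
      hf.continuousAt.preimage_mem_nhds (extChartAt_source_mem_nhds (I := I') (f x))]
      with y h1 h2 h3
    exact ⟨h1.mdifferentiableAt (by simp), h2, h3⟩
  have hgd : ∀ {y : N}, MDifferentiableAt I I' f y → y ∈ φ.source → f y ∈ ψ.source →
      ∀ v : TangentSpace I y, fderiv ℝ g (φ y) (mfderiv I 𝓘(ℝ, E) φ y v)
        = mfderiv I' 𝓘(ℝ, E') ψ (f y) (mfderiv I I' f y v) := by
    intro y h1 h2 h3 v
    have e1 : HasMFDerivAt I 𝓘(ℝ, E') (ψ ∘ f) y _ :=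
      (mdifferentiableAt_extChartAt (I := I') (by simpa [ψ] using h3)).hasMFDerivAt.comp y
        h1.hasMFDerivAt
    have hgy : DifferentiableAt ℝ g (φ y) := by
      have h4 : MDifferentiableAt 𝓘(ℝ, E) I φ.symm (φ y) := by
        rw [← mdifferentiableWithinAt_univ, ← I.range_eq_univ]
        exact mdifferentiableWithinAt_extChartAt_symm (φ.map_source h2)
      have hc : g = (ψ ∘ f) ∘ φ.symm := rfl
      rw [hc]
      refine mdifferentiableAt_iff_differentiableAt.1 (MDifferentiableAt.comp (φ y) ?_ h4)
      rw [φ.left_inv h2]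
      exact e1.mdifferentiableAt
    have e2 : HasMFDerivAt I 𝓘(ℝ, E') (g ∘ φ) y _ := HasMFDerivAt.comp y (g := g)
      hgy.hasFDerivAt.hasMFDerivAt
      (mdifferentiableAt_extChartAt (I := I) (by simpa [φ] using h2)).hasMFDerivAt
    have e3 : g ∘ φ =ᶠ[𝓝 y] ψ ∘ f := by
      filter_upwards [(isOpen_extChartAt_source (I := I) x).mem_nhds h2] with z hz
      simp [g, φ.left_inv hz]
    exact DFunLike.congr_fun (hasMFDerivAt_unique (e2.congr_of_eventuallyEq e3.symm) e1) v
  have hrel : ∀ {U : Π y : N, TangentSpace I y} {U' : Π y : N', TangentSpace I' y},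
      (∀ᶠ y in 𝓝 x, mfderiv I I' f y (U y) = U' (f y)) →
      ∀ᶠ z in 𝓝 (φ x), fderiv ℝ g z (chartField I x U z) = chartField I' (f x) U' (g z) := by
    intro U U' h
    have hc : Tendsto φ.symm (𝓝 (φ x)) (𝓝 x) := by
      have := continuousAt_extChartAt_symm (I := I) x
      rwa [ContinuousAt, extChartAt_to_inv] at this
    filter_upwards [hc.eventually h, hc.eventually hfe, extChartAt_target_mem_nhds (I := I) x]
      with z h1 h2 h3
    obtain ⟨y, hy, rfl⟩ : ∃ y ∈ φ.source, φ y = z := ⟨φ.symm z, φ.map_target h3, φ.right_inv h3⟩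
    rw [φ.left_inv hy] at h1 h2
    have : g (φ y) = ψ (f y) := by simp [g, φ.left_inv hy]
    rw [this, chartField_extChartAt U hy, chartField_extChartAt U' h2.2.2, hgd h2.1 hy h2.2.2, h1]
  have hgx : g (φ x) = ψ (f x) := by simp [g, hx]
  have main := fderiv_lieBracket_of_related hg (differentiableAt_chartField hV)
    (differentiableAt_chartField hW) (by rw [hgx]; exact differentiableAt_chartField hV')
    (by rw [hgx]; exact differentiableAt_chartField hW') (hrel hVV') (hrel hWW')
  obtain ⟨h1, h2, h3⟩ := hfe.self_of_nhds
  rw [hgx, ← mfderiv_extChartAt_mlieBracket, ← mfderiv_extChartAt_mlieBracket, hgd h1 h2 h3] at main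
  exact (isInvertible_mfderiv_extChartAt h3).injective main

end Related

open Filter Topology Set

variable {EM EG EP M G P : Type*}
  [NormedAddCommGroup EM] [NormedSpace ℝ EM] [FiniteDimensional ℝ EM]
  [NormedAddCommGroup EG] [NormedSpace ℝ EG] [FiniteDimensional ℝ EG]
  [NormedAddCommGroup EP] [NormedSpace ℝ EP] [FiniteDimensional ℝ EP]
  [TopologicalSpace M] [ChartedSpace EM M] [IsManifold 𝓘(ℝ, EM) ∞ M]
  [TopologicalSpace G] [ChartedSpace EG G] [Group G] [LieGroup 𝓘(ℝ, EG) ∞ G]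
  [TopologicalSpace P] [ChartedSpace EP P] [IsManifold 𝓘(ℝ, EP) ∞ P]
  [MulAction Gᵐᵒᵖ P]

/-! ### Calculus on principal bundles -/

section Calculus

variable {E H N E' H' N' : Type*}
  [NormedAddCommGroup E] [NormedSpace ℝ E] [TopologicalSpace H] {I : ModelWithCorners ℝ E H}
  [TopologicalSpace N] [ChartedSpace H N]
  [NormedAddCommGroup E'] [NormedSpace ℝ E'] [TopologicalSpace H'] {I' : ModelWithCorners ℝ E' H'}
  [TopologicalSpace N'] [ChartedSpace H' N']

/-- Base points such as `ract p 1` and `p` are equal only propositionally, but every tangent space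
is the model space. This lemma and the next move vectors between such points. -/
lemma tangentBundle_mk_congr {x y : N} (h : x = y) (v : E) :
    (⟨x, v⟩ : TangentBundle I N) = ⟨y, v⟩ := by
  subst h; rfl

lemma mfderiv_apply_congr {f : N → N'} {x y : N} (h : x = y) (v : E) :
    (mfderiv I I' f x v : E') = mfderiv I I' f y v := by
  subst h; rfl

/-- The field `(V, 0)` on `N × N'`. -/
def fieldInl (I : ModelWithCorners ℝ E H) (I' : ModelWithCorners ℝ E' H')
    (V : Π x : N, TangentSpace I x) :
    Π q : N × N', TangentSpace (I.prod I') q := fun q => ((V q.1 : E), (0 : E'))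

/-- The field `(0, V')` on `N × N'`. -/
def fieldInr (I : ModelWithCorners ℝ E H) (I' : ModelWithCorners ℝ E' H')
    (V' : Π x : N', TangentSpace I' x) :
    Π q : N × N', TangentSpace (I.prod I') q := fun q => ((0 : E), (V' q.2 : E'))

variable [IsManifold I 1 N] [IsManifold I' 1 N']

/-- Differentiability of a pair of maps to tangent bundles. -/
lemma mdifferentiableAt_tangentBundle_prod {EQ Q : Type*} [NormedAddCommGroup EQ]
    [NormedSpace ℝ EQ] {HQ : Type*} [TopologicalSpace HQ] {J : ModelWithCorners ℝ EQ HQ}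
    [TopologicalSpace Q] [ChartedSpace HQ Q]
    {γ : Q → TangentBundle I N} {γ' : Q → TangentBundle I' N'} {q : Q}
    (h : MDifferentiableAt J I.tangent γ q) (h' : MDifferentiableAt J I'.tangent γ' q) :
    MDifferentiableAt J (I.prod I').tangent
      (fun q => (⟨((γ q).1, (γ' q).1), ((γ q).2, (γ' q).2)⟩ :
        TangentBundle (I.prod I') (N × N'))) q :=
  ((contMDiff_equivTangentBundleProd_symm (n := 1) (I := I) (I' := I') (M := N)
    (M' := N')).mdifferentiable (by simp) _).comp q (h.prodMk h')

lemma mdifferentiableAt_fieldInl {V : Π x : N, TangentSpace I x} {q : N × N'}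
    (hV : MDiffAt (T% V) q.1) : MDifferentiableAt (I.prod I') (I.prod I').tangent
      (fun q => (⟨q, fieldInl I I' V q⟩ : TangentBundle (I.prod I') (N × N'))) q :=
  mdifferentiableAt_tangentBundle_prod (hV.comp q mdifferentiableAt_fst)
    ((mdifferentiable_zeroSection ℝ (TangentSpace I' : N' → Type _) q.2).comp q
      mdifferentiableAt_snd)

lemma mdifferentiableAt_fieldInr {V' : Π x : N', TangentSpace I' x} {q : N × N'}
    (hV : MDiffAt (T% V') q.2) : MDifferentiableAt (I.prod I') (I.prod I').tangent
      (fun q => (⟨q, fieldInr I I' V' q⟩ : TangentBundle (I.prod I') (N × N'))) q :=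
  mdifferentiableAt_tangentBundle_prod
    ((mdifferentiable_zeroSection ℝ (TangentSpace I : N → Type _) q.1).comp q
      mdifferentiableAt_fst) (hV.comp q mdifferentiableAt_snd)

end Calculus

/-- Each projection of the product relates one of the two fields to the zero field, so both
components of the bracket are brackets with zero. -/
lemma mlieBracket_fieldInl_fieldInr {E H N E' H' N' : Type*}
    [NormedAddCommGroup E] [NormedSpace ℝ E] [CompleteSpace E]
    [TopologicalSpace H] {I : ModelWithCorners ℝ E H} [I.Boundaryless]
    [TopologicalSpace N] [ChartedSpace H N] [IsManifold I 2 N]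
    [NormedAddCommGroup E'] [NormedSpace ℝ E'] [CompleteSpace E']
    [TopologicalSpace H'] {I' : ModelWithCorners ℝ E' H'} [I'.Boundaryless]
    [TopologicalSpace N'] [ChartedSpace H' N'] [IsManifold I' 2 N']
    {V : Π x : N, TangentSpace I x} {V' : Π x : N', TangentSpace I' x} {q : N × N'}
    (hV : MDiffAt (T% V) q.1) (hV' : MDiffAt (T% V') q.2) :
    mlieBracket (I.prod I') (fieldInl I I' V) (fieldInr I I' V') q = 0 := by
  have : IsManifold I 1 N := .of_le (n := 2) (by norm_num)
  have : IsManifold I' 1 N' := .of_le (n := 2) (by norm_num)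
  have : IsManifold (I.prod I') 2 (N × N') := inferInstance
  have h1 := mfderiv_mlieBracket_of_related (I := I.prod I') (I' := I) (f := Prod.fst) (x := q)
    (V := fieldInl I I' V) (W := fieldInr I I' V') (V' := V) (W' := 0)
    contMDiffAt_fst (mdifferentiableAt_fieldInl hV) (mdifferentiableAt_fieldInr hV') hV
    (mdifferentiable_zeroSection ℝ (TangentSpace I : N → Type _) q.1)
    (Eventually.of_forall fun y => by rw [mfderiv_fst]; rfl)
    (Eventually.of_forall fun y => by rw [mfderiv_fst]; rfl)
  have h2 := mfderiv_mlieBracket_of_related (I := I.prod I') (I' := I') (f := Prod.snd) (x := q)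
    (V := fieldInl I I' V) (W := fieldInr I I' V') (V' := 0) (W' := V')
    contMDiffAt_snd (mdifferentiableAt_fieldInl hV) (mdifferentiableAt_fieldInr hV')
    (mdifferentiable_zeroSection ℝ (TangentSpace I' : N' → Type _) q.2) hV'
    (Eventually.of_forall fun y => by rw [mfderiv_snd]; rfl)
    (Eventually.of_forall fun y => by rw [mfderiv_snd]; rfl)
  rw [mfderiv_fst, mlieBracket_zero_right] at h1
  rw [mfderiv_snd, mlieBracket_zero_left] at h2
  exact Prod.ext h1 h2

/-! ### Infinitesimal action: invariant and fundamental fields. -/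

namespace SmoothPrincipalBundle

variable (B : SmoothPrincipalBundle EM EG EP M G P)
include B

lemma contMDiff_ract_left (g : G) :
    ContMDiff 𝓘(ℝ, EP) 𝓘(ℝ, EP) ∞ (fun q : P => ract q g) :=
  B.contMDiff_act.comp (contMDiff_id.prodMk contMDiff_const)

lemma contMDiff_ract_right (p : P) :
    ContMDiff 𝓘(ℝ, EG) 𝓘(ℝ, EP) ∞ (fun g : G => ract p g) :=
  B.contMDiff_act.comp (contMDiff_const.prodMk contMDiff_id)

lemma mfderiv_act (p : P) (g : G) (v : TangentSpace 𝓘(ℝ, EP) p) (w : TangentSpace 𝓘(ℝ, EG) g) :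
    mfderiv (𝓘(ℝ, EP).prod 𝓘(ℝ, EG)) 𝓘(ℝ, EP) (fun q : P × G => ract q.1 q.2) (p, g) (v, w)
      = mfderiv 𝓘(ℝ, EP) 𝓘(ℝ, EP) (fun q : P => ract q g) p v
        + mfderiv 𝓘(ℝ, EG) 𝓘(ℝ, EP) (fun h : G => ract p h) g w :=
  mfderiv_prod_eq_add_apply (B.contMDiff_act.mdifferentiable (by simp) _)

lemma ract_ract (p : P) (g h : G) : ract (ract p g) h = ract p (g * h) := by
  simp [ract, mul_smul]

/-- Since (pg)h = p(gh), the orbit map through `p` relates left-invariant fields on `G` to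
fundamental fields on `P`. -/
lemma mfderiv_ract_mulInvariant (z : LieAlg EG G) (p : P) (g : G) :
    mfderiv 𝓘(ℝ, EG) 𝓘(ℝ, EP) (fun h : G => ract p h) g (mulInvariantVectorField z g)
      = fundField z (ract p g) := by
  have e : (fun h : G => ract (ract p g) h) = (fun h : G => ract p h) ∘ (g * ·) := by
    ext h; exact B.ract_ract p g h
  have h1 : MDifferentiableAt 𝓘(ℝ, EG) 𝓘(ℝ, EG) (fun h : G => g * h) 1 :=
    (contMDiff_mul_left (I := 𝓘(ℝ, EG)) (n := ∞) (a := g)).mdifferentiable (by simp) _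
  have h2 := mfderiv_comp_apply (I := 𝓘(ℝ, EG)) (I' := 𝓘(ℝ, EG)) (I'' := 𝓘(ℝ, EP)) (1 : G)
    (f := fun h : G => g * h) (g := fun h : G => ract p h)
    ((B.contMDiff_ract_right p).mdifferentiable (by simp) _) h1 z
  rw [fundField, e]
  exact (mfderiv_apply_congr (mul_one g).symm _).trans h2.symm

variable {B} in
/-- Invariant vector fields commute with fundamental vector fields. -/
lemma lie_fundField_eq_zero {X : VField EP P} {p : P} (hX : MDiffAt (T% X) p)
    (hinv : ∀ (p : P) (g : G),
      X (ract p g) = mfderiv 𝓘(ℝ, EP) 𝓘(ℝ, EP) (fun q : P => ract q g) p (X p))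
    (z : LieAlg EG G) (hz : MDiffAt (T% (fundField z : VField EP P)) p) :
    lie X (fundField z) p = 0 := by
  have hp : ract p (1 : G) = p := by simp [ract]
  have : LieGroup 𝓘(ℝ, EG) (minSmoothness ℝ 3) G := .of_le (n := ∞)
    (by rw [minSmoothness_of_isRCLikeNormedField]; exact ENat.LEInfty.out)
  have hL := mdifferentiableAt_mulInvariantVectorField (I := 𝓘(ℝ, EG)) z (g := (1 : G))
  -- The action map relates (X, 0) to `X`, by invariance, and (0, left-invariant field) to the
  -- fundamental field. The fields upstairs commute.
  have h := mfderiv_mlieBracket_of_related (x := (p, (1 : G))) (I := 𝓘(ℝ, EP).prod 𝓘(ℝ, EG))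
    (I' := 𝓘(ℝ, EP)) (f := fun q : P × G => ract q.1 q.2)
    (V := fieldInl 𝓘(ℝ, EP) 𝓘(ℝ, EG) X)
    (W := fieldInr 𝓘(ℝ, EP) 𝓘(ℝ, EG) (mulInvariantVectorField z))
    (V' := X) (W' := fundField z) (B.contMDiff_act.contMDiffAt.of_le ENat.LEInfty.out)
    (mdifferentiableAt_fieldInl hX) (mdifferentiableAt_fieldInr hL)
    (by simpa only [hp] using hX) (by simpa only [hp] using hz)
    (Eventually.of_forall fun y => by
      have := B.mfderiv_act y.1 y.2 (X y.1) 0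
      rw [map_zero, add_zero, ← hinv] at this
      exact this)
    (Eventually.of_forall fun y => by
      have := B.mfderiv_act y.1 y.2 0 (mulInvariantVectorField z y.2)
      rw [map_zero, zero_add, B.mfderiv_ract_mulInvariant] at this
      exact this)
  rw [mlieBracket_fieldInl_fieldInr hX hL, map_zero] at h
  have key : ∀ q, q = p → lie X (fundField z) q = 0 → lie X (fundField z) p = 0 := by
    rintro _ rfl h; exact h
  exact key _ hp h.symm

end SmoothPrincipalBundle

namespace SmoothPrincipalBundle

/-! ### Local trivializations -/

variable (B : SmoothPrincipalBundle EM EG EP M G P)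

/-- Smooth equivariant trivializations. -/
structure IsEquivTriv (t : Trivialization G B.proj) : Prop where
  contMDiffOn : ContMDiffOn 𝓘(ℝ, EP) (𝓘(ℝ, EM).prod 𝓘(ℝ, EG)) ∞ t.toOpenPartialHomeomorph t.source
  contMDiffOn_symm : ContMDiffOn (𝓘(ℝ, EM).prod 𝓘(ℝ, EG)) 𝓘(ℝ, EP) ∞
    t.toOpenPartialHomeomorph.symm t.target
  equivariant : ∀ p ∈ t.source, ∀ g : G,
    (t.toOpenPartialHomeomorph (ract p g)).2 = (t.toOpenPartialHomeomorph p).2 * g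

lemma exists_isEquivTriv (x : M) : ∃ t, B.IsEquivTriv t ∧ x ∈ t.baseSet := by
  obtain ⟨t, hx, h1, h2, h3⟩ := B.locallyTrivial x
  exact ⟨t, ⟨h1, h2, h3⟩, hx⟩

variable {B} {t : Trivialization G B.proj} (ht : B.IsEquivTriv t)

namespace IsEquivTriv
include ht

lemma mdifferentiable :
    t.toOpenPartialHomeomorph.MDifferentiable 𝓘(ℝ, EP) (𝓘(ℝ, EM).prod 𝓘(ℝ, EG)) :=
  ⟨ht.contMDiffOn.mdifferentiableOn (by simp), ht.contMDiffOn_symm.mdifferentiableOn (by simp)⟩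

lemma apply_eq {p : P} (hp : B.proj p ∈ t.baseSet) :
    t.toOpenPartialHomeomorph p = (B.proj p, (t.toOpenPartialHomeomorph p).2) :=
  Prod.ext (t.proj_toFun p (t.mem_source.2 hp)) rfl

/-- By equivariance the inverse trivialization, restricted to a fibre, is an orbit map precomposed
with a left translation. This yields transitivity on fibres and the description of vertical vectors.
-/
lemma symm_apply {p : P} (hp : B.proj p ∈ t.baseSet) (h : G) :
    t.toOpenPartialHomeomorph.symm (B.proj p, h)
      = ract p ((t.toOpenPartialHomeomorph p).2⁻¹ * h) := by
  set k := (t.toOpenPartialHomeomorph p).2⁻¹ * h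
  have hk : B.proj (ract p k) ∈ t.baseSet := by rwa [B.proj_act]
  have h1 := ht.apply_eq hk
  rw [ht.equivariant p (t.mem_source.2 hp), B.proj_act, mul_inv_cancel_left] at h1
  rw [← h1, t.toOpenPartialHomeomorph.left_inv (t.mem_source.2 hk)]

lemma symm_apply_self {p : P} (hp : B.proj p ∈ t.baseSet) :
    t.toOpenPartialHomeomorph.symm (B.proj p, (t.toOpenPartialHomeomorph p).2) = p := by
  rw [← ht.apply_eq hp, t.toOpenPartialHomeomorph.left_inv (t.mem_source.2 hp)]

lemma mfderiv_proj_symm {y : M × G} (hy : y ∈ t.target)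
    (w : TangentSpace (𝓘(ℝ, EM).prod 𝓘(ℝ, EG)) y) :
    (mfderiv 𝓘(ℝ, EP) 𝓘(ℝ, EM) B.proj (t.toOpenPartialHomeomorph.symm y)
      (mfderiv (𝓘(ℝ, EM).prod 𝓘(ℝ, EG)) 𝓘(ℝ, EP) t.toOpenPartialHomeomorph.symm y w) : EM)
      = w.1 := by
  have h1 := mfderiv_comp_apply y (B.contMDiff_proj.mdifferentiable (by simp) _)
    (ht.mdifferentiable.mdifferentiableAt_symm hy) w
  have h2 : B.proj ∘ t.toOpenPartialHomeomorph.symm =ᶠ[𝓝 y] Prod.fst := by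
    filter_upwards [t.open_target.mem_nhds hy] with z hz using t.proj_symm_apply hz
  rw [h2.mfderiv_eq, mfderiv_fst] at h1
  exact h1.symm

end IsEquivTriv

variable (B)

lemma exists_ract_of_proj_eq {p q : P} (h : B.proj p = B.proj q) : ∃ g : G, q = ract p g := by
  obtain ⟨t, ht, hx⟩ := B.exists_isEquivTriv (B.proj p)
  have h1 := ht.symm_apply_self (h ▸ hx : B.proj q ∈ t.baseSet)
  rw [← h, ht.symm_apply hx] at h1
  exact ⟨_, h1.symm⟩

lemma mfderiv_proj_surjective (p : P) (v : EM) :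
    ∃ w : EP, (mfderiv 𝓘(ℝ, EP) 𝓘(ℝ, EM) B.proj p w : EM) = v := by
  obtain ⟨t, ht, hx⟩ := B.exists_isEquivTriv (B.proj p)
  have hy : (B.proj p, (t.toOpenPartialHomeomorph p).2) ∈ t.target := t.mem_target.2 hx
  have h := ht.mfderiv_proj_symm hy (v, (0 : EG))
  exact ⟨_, (mfderiv_apply_congr (ht.symm_apply_self hx).symm _).trans h⟩

lemma mfderiv_proj_ract (p : P) (g : G) (v : TangentSpace 𝓘(ℝ, EP) p) :
    (mfderiv 𝓘(ℝ, EP) 𝓘(ℝ, EM) B.proj (ract p g)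
      (mfderiv 𝓘(ℝ, EP) 𝓘(ℝ, EP) (fun q : P => ract q g) p v) : EM)
      = mfderiv 𝓘(ℝ, EP) 𝓘(ℝ, EM) B.proj p v := by
  have h1 := mfderiv_comp_apply p (B.contMDiff_proj.mdifferentiable (by simp) (ract p g))
    ((B.contMDiff_ract_left g).mdifferentiable (by simp) p) v
  have h2 : B.proj ∘ (fun q : P => ract q g) = B.proj := funext fun q => B.proj_act q g
  rw [h2] at h1
  exact h1.symm

lemma mfderiv_proj_fundField (z : LieAlg EG G) (p : P) :
    (mfderiv 𝓘(ℝ, EP) 𝓘(ℝ, EM) B.proj p (fundField z p) : EM) = 0 := by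
  have hp : p = ract p (1 : G) := by simp [ract]
  have h1 := mfderiv_comp_apply (1 : G) (B.contMDiff_proj.mdifferentiable (by simp) (ract p (1 : G)))
    ((B.contMDiff_ract_right p).mdifferentiable (by simp) 1) z
  have h2 : B.proj ∘ (fun g : G => ract p g) = fun _ => B.proj p := funext fun g => B.proj_act p g
  rw [h2, mfderiv_const] at h1
  exact (mfderiv_apply_congr hp _).trans h1.symm

/-- In a trivialization a vertical vector has zero `M`-component, so it is the image of its
`G`-component under an orbit map. The witness is that component left-translated to the identity. -/
lemma exists_eq_fundField {p : P} {v : TangentSpace 𝓘(ℝ, EP) p}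
    (hv : (mfderiv 𝓘(ℝ, EP) 𝓘(ℝ, EM) B.proj p v : EM) = 0) :
    ∃ z : LieAlg EG G, v = fundField z p := by
  obtain ⟨t, ht, hx⟩ := B.exists_isEquivTriv (B.proj p)
  set T := t.toOpenPartialHomeomorph
  have hp : p ∈ T.source := t.mem_source.2 hx
  set J := 𝓘(ℝ, EM).prod 𝓘(ℝ, EG)
  let w : EM × EG := mfderiv 𝓘(ℝ, EP) J T p v
  have hTp : T p = (B.proj p, (T p).2) := ht.apply_eq hx
  have hw1 : w.1 = 0 := by
    have h1 := mfderiv_comp_apply p (mdifferentiableAt_fst (I := 𝓘(ℝ, EM)) (I' := 𝓘(ℝ, EG)))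
      (ht.mdifferentiable.mdifferentiableAt hp) v
    have h2 : Prod.fst ∘ T =ᶠ[𝓝 p] B.proj := by
      filter_upwards [T.open_source.mem_nhds hp] with z hz using t.proj_toFun z hz
    rw [h2.mfderiv_eq, mfderiv_fst] at h1
    exact h1.symm.trans hv
  have h3 : (mfderiv J 𝓘(ℝ, EP) T.symm (T p) w : EP) = v :=
    DFunLike.congr_fun (ht.mdifferentiable.symm_comp_deriv hp) v
  set g := (T p).2
  have h4 : (mfderiv J 𝓘(ℝ, EP) T.symm (B.proj p, g) ((0 : EM), w.2) : EP) = v := by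
    rw [← h3, ← hw1]
    exact mfderiv_apply_congr hTp.symm _
  have h5 := mfderiv_comp_apply (I := 𝓘(ℝ, EG)) (I' := J) (I'' := 𝓘(ℝ, EP)) g
    (g := T.symm) (f := fun h : G => (B.proj p, h))
    (ht.mdifferentiable.mdifferentiableAt_symm (t.mem_target.2 hx))
    (mdifferentiableAt_const.prodMk mdifferentiableAt_id) w.2
  have h6 : T.symm ∘ (fun h : G => (B.proj p, h)) = (fun h : G => ract p h) ∘ (g⁻¹ * ·) :=
    funext fun h => ht.symm_apply hx h
  have h7 := mfderiv_comp_apply (I := 𝓘(ℝ, EG)) (I' := 𝓘(ℝ, EG)) (I'' := 𝓘(ℝ, EP)) g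
    (g := fun h : G => ract p h) (f := fun h : G => g⁻¹ * h)
    ((B.contMDiff_ract_right p).mdifferentiable (by simp) _)
    ((contMDiff_mul_left (I := 𝓘(ℝ, EG)) (n := ∞) (a := g⁻¹)).mdifferentiable (by simp) _) w.2
  rw [h6, h7, mfderiv_prod_right] at h5
  refine ⟨(mfderiv 𝓘(ℝ, EG) 𝓘(ℝ, EG) (fun h : G => g⁻¹ * h) g w.2 : EG), ?_⟩
  refine h4.symm.trans (h5.symm.trans ?_)
  exact mfderiv_apply_congr (inv_mul_cancel g) _

end SmoothPrincipalBundle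

/-! ### Pointwise differentiability, and brackets with combinations of commuting fields. -/

lemma one_add_one_le_infty : (1 + 1 : WithTop ℕ∞) ≤ ∞ := by
  rw [one_add_one_eq_two]; exact ENat.LEInfty.out

lemma field_congr {E N : Type*} [NormedAddCommGroup E] [NormedSpace ℝ E]
    [TopologicalSpace N] [ChartedSpace E N] (Z : VField E N) {x y : N} (h : x = y) :
    (Z x : E) = Z y := by
  subst h; rfl

lemma SmoothField.mdifferentiableAt {E N : Type*} [NormedAddCommGroup E] [NormedSpace ℝ E]
    [TopologicalSpace N] [ChartedSpace E N] [IsManifold 𝓘(ℝ, E) ∞ N] {X : VField E N}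
    (hX : SmoothField X) (x : N) : MDiffAt (T% X) x :=
  ContMDiff.mdifferentiable hX (by simp) x

/-- A differentiable 1-form evaluated on a differentiable vector field is differentiable. -/
lemma SmoothForm.mdifferentiableAt_apply {E N : Type*} [NormedAddCommGroup E] [NormedSpace ℝ E]
    [TopologicalSpace N] [ChartedSpace E N] [IsManifold 𝓘(ℝ, E) ∞ N]
    {F : Type*} [NormedAddCommGroup F] [NormedSpace ℝ F]
    {ξ : Π x : N, TangentSpace 𝓘(ℝ, E) x →L[ℝ] F} (hξ : SmoothForm ξ) {X : VField E N} {x : N}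
    (hX : MDiffAt (T% X) x) :
    MDifferentiableAt 𝓘(ℝ, E) 𝓘(ℝ, F) (fun y => ξ y (X y)) x := by
  have h := MDifferentiableAt.clm_bundle_apply (F₁ := E) (F₂ := F)
    (E₁ := (TangentSpace 𝓘(ℝ, E) : N → Type _)) (E₂ := Bundle.Trivial N F) (b := id)
    (ϕ := ξ) (v := X) (x := x) (ContMDiff.mdifferentiable hξ (by simp) x) hX
  exact ((mdifferentiableAt_totalSpace _ _).1 h).2

lemma mlieBracket_sum_smul_of_commute {E N ι : Type*} [NormedAddCommGroup E] [NormedSpace ℝ E]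
    [CompleteSpace E] [TopologicalSpace N] [ChartedSpace E N] [IsManifold 𝓘(ℝ, E) 2 N]
    {h : VField E N} {x : N} (s : Finset ι) {f : ι → N → ℝ} {Y : ι → VField E N}
    (hf : ∀ i, MDifferentiableAt 𝓘(ℝ, E) 𝓘(ℝ) (f i) x) (hY : ∀ i, MDiffAt (T% (Y i)) x)
    (hc : ∀ i, lie h (Y i) x = 0) :
    lie h (fun y => ∑ i ∈ s, f i y • Y i y) x
      = ∑ i ∈ s, mvfderiv 𝓘(ℝ, E) (f i) x (h x) • Y i x := by
  classical
  have : IsManifold 𝓘(ℝ, E) 1 N := .of_le (n := 2) (by norm_num)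
  induction s using Finset.induction_on with
  | empty =>
    simp only [Finset.sum_empty]
    exact congrFun (mlieBracket_zero_right (I := 𝓘(ℝ, E)) (W := h)) x
  | insert i s hi ih =>
    have e : (fun y => ∑ j ∈ insert i s, f j y • Y j y)
        = (f i • Y i) + fun y => ∑ j ∈ s, f j y • Y j y := by
      funext y; simp [Finset.sum_insert hi]
    have hm : MDiffAt (T% (fun y => ∑ j ∈ s, f j y • Y j y : VField E N)) x :=
      .sum_section (t := fun j => f j • Y j) fun j _ => (hf j).smul_section (hY j)
    have hci : mlieBracket 𝓘(ℝ, E) h (Y i) x = 0 := hc i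
    rw [e, lie, mlieBracket_add_right ((hf i).smul_section (hY i)) hm]
    refine (congrArg _ ih).trans ?_
    rw [Finset.sum_insert hi, mlieBracket_smul_right (hf i) (hY i), hci, smul_zero, add_zero]

/-! ### Invariant fields: descent to the base and brackets with vertical fields. -/

namespace SmoothPrincipalBundle

variable (B : SmoothPrincipalBundle EM EG EP M G P)

/-- Invariance of a vector field on `P` under the action. -/
def Invariant (_B : SmoothPrincipalBundle EM EG EP M G P) (X : VField EP P) : Prop :=
  ∀ (p : P) (g : G),
    X (ract p g) = mfderiv 𝓘(ℝ, EP) 𝓘(ℝ, EP) (fun q : P => ract q g) p (X p)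

variable {B}

lemma Invariant.sub {X Y : VField EP P} (hX : B.Invariant X) (hY : B.Invariant Y) :
    B.Invariant (X - Y) := fun p g => by
  rw [Pi.sub_apply, Pi.sub_apply, map_sub, ← hX p g, ← hY p g]

lemma proj_point (x : M) : B.proj (B.point x) = x := Function.surjInv_eq B.surjective x

/-- `push` uses one arbitrarily chosen point of each fibre. Invariance and transitivity on fibres
make its value independent of that choice. -/
lemma Invariant.mfderiv_proj {X : VField EP P} (hX : B.Invariant X) (q : P) :
    (mfderiv 𝓘(ℝ, EP) 𝓘(ℝ, EM) B.proj q (X q) : EM) = B.push X (B.proj q) := by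
  obtain ⟨g, hg⟩ := B.exists_ract_of_proj_eq (B.proj_point (B.proj q)).symm
  refine (B.mfderiv_proj_ract q g (X q)).symm.trans ?_
  rw [← hX q g, ← hg]
  rfl

/-- The choice `point` has no regularity, so it is replaced near `x` by the smooth local section `s`
coming from a trivialization. -/
lemma Invariant.mdifferentiableAt_push {X : VField EP P} (hX : B.Invariant X)
    (hd : ∀ p, MDiffAt (T% X) p) (x : M) : MDiffAt (T% (B.push X)) x := by
  obtain ⟨t, ht, hx⟩ := B.exists_isEquivTriv x
  set s : M → P := fun y => t.toOpenPartialHomeomorph.symm (y, 1)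
  have hs : MDifferentiableAt 𝓘(ℝ, EM) 𝓘(ℝ, EP) s x :=
    MDifferentiableAt.comp x (ht.mdifferentiable.mdifferentiableAt_symm (t.mem_target.2 hx))
      (mdifferentiableAt_id.prodMk mdifferentiableAt_const)
  have h : MDifferentiableAt 𝓘(ℝ, EM) 𝓘(ℝ, EM).tangent
      (tangentMap 𝓘(ℝ, EP) 𝓘(ℝ, EM) B.proj ∘ (T% X) ∘ s) x :=
    MDifferentiableAt.comp x
      ((B.contMDiff_proj.contMDiff_tangentMap (m := 1) one_add_one_le_infty).mdifferentiable
        (by simp) _) ((hd (s x)).comp x hs)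
  refine h.congr_of_eventuallyEq ?_
  filter_upwards [t.open_baseSet.mem_nhds hx] with y hy
  have hy' : B.proj (s y) = y := t.proj_symm_apply (t.mem_target.2 hy)
  have e : (mfderiv 𝓘(ℝ, EP) 𝓘(ℝ, EM) B.proj (s y) (X (s y)) : EM) = B.push X y :=
    (hX.mfderiv_proj (s y)).trans (field_congr (B.push X) hy')
  exact (congrArg (fun v : EM => (⟨y, v⟩ : TangentBundle 𝓘(ℝ, EM) M)) e).symm.trans
    (tangentBundle_mk_congr hy' _).symm

-- The field is the tangent map of the action applied to the vector (0, a q) at (q, 1), hence a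
-- composite of differentiable maps.
variable (B) in
include B in
lemma mdifferentiableAt_fundField {a : P → EG} {p : P}
    (ha : MDifferentiableAt 𝓘(ℝ, EP) 𝓘(ℝ, EG) a p) :
    MDiffAt (T% (fun q => fundField (EG := EG) (G := G) (a q) q : VField EP P)) p := by
  have h1 : MDifferentiableAt 𝓘(ℝ, EP) 𝓘(ℝ, EG).tangent
      (fun q => (⟨(1 : G), a q⟩ : TangentBundle 𝓘(ℝ, EG) G)) p := by
    refine (mdifferentiableAt_totalSpace _ _).2 ⟨mdifferentiableAt_const, ?_⟩
    set e := trivializationAt EG (TangentSpace 𝓘(ℝ, EG) : G → Type _) (1 : G)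
    let L : EG →L[ℝ] EG := e.continuousLinearMapAt ℝ (1 : G)
    have hL : (fun q => (e (⟨(1 : G), a q⟩ : TangentBundle 𝓘(ℝ, EG) G)).2) = L ∘ a := by
      funext q
      have h1 : (1 : G) ∈ e.baseSet := FiberBundle.mem_baseSet_trivializationAt' (1 : G)
      exact (congrFun (e.coe_linearMapAt_of_mem (R := ℝ) h1) (a q)).symm
    refine MDifferentiableAt.congr_of_eventuallyEq (f := L ∘ a)
      (MDifferentiableAt.comp p L.differentiableAt.mdifferentiableAt ha) (.of_eq hL)
  have h2 := mdifferentiableAt_tangentBundle_prod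
    (mdifferentiable_zeroSection ℝ (TangentSpace 𝓘(ℝ, EP) : P → Type _) p) h1
  have h3 := MDifferentiableAt.comp p
    ((B.contMDiff_act.contMDiff_tangentMap (m := 1) one_add_one_le_infty).mdifferentiable (by simp) _)
    h2
  convert! h3 using 1
  ext q : 1
  have hq : ract q (1 : G) = q := by simp [ract]
  refine (tangentBundle_mk_congr hq.symm _).trans ?_
  have := B.mfderiv_act q 1 0 (a q)
  rw [map_zero, zero_add] at this
  exact congrArg (fun v : EP => (⟨ract q (1 : G), v⟩ : TangentBundle 𝓘(ℝ, EP) P)) this.symm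

include B in
/-- The bracket of an invariant field with a vertical field. -/
lemma lie_fundField {h : VField EP P} (hinv : B.Invariant h) {p : P} (hh : MDiffAt (T% h) p)
    {a : P → EG}
    (ha : MDifferentiableAt 𝓘(ℝ, EP) 𝓘(ℝ, EG) a p) :
    lie h (fun q => fundField (EG := EG) (G := G) (a q) q) p
      = fundField (EG := EG) (G := G) (mvfderiv 𝓘(ℝ, EP) a p (h p)) p := by
  -- In a basis of the Lie algebra the vertical field is a combination of fundamental fields. These
  -- commute with `h`, so only the derivatives of the coefficients survive.
  let b := Module.finBasis ℝ EG
  let ℓ : ∀ i, EG →L[ℝ] ℝ := fun i => LinearMap.toContinuousLinearMap (b.coord i)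
  let f : Fin (Module.finrank ℝ EG) → P → ℝ := fun i q => ℓ i (a q)
  let Y : Fin (Module.finrank ℝ EG) → VField EP P := fun i =>
    fundField (EG := EG) (G := G) (b i)
  have hsum : ∀ (q : P) (z : EG),
      fundField (EG := EG) (G := G) z q = ∑ i, ℓ i z • Y i q := fun q z => by
    have h1 : z = ∑ i, ℓ i z • b i := (b.sum_repr z).symm
    let D : EG →L[ℝ] EP := mfderiv 𝓘(ℝ, EG) 𝓘(ℝ, EP) (fun g : G => ract q g) 1
    have h2 : D z = ∑ i, ℓ i z • D (b i) := by
      conv_lhs => rw [h1, map_sum]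
      simp only [map_smul]
    exact h2
  have hf : ∀ i, MDifferentiableAt 𝓘(ℝ, EP) 𝓘(ℝ) (f i) p := fun i =>
    MDifferentiableAt.comp p (ℓ i).differentiableAt.mdifferentiableAt ha
  have hY : ∀ i, MDiffAt (T% (Y i)) p := fun i =>
    B.mdifferentiableAt_fundField (a := fun _ => b i) mdifferentiableAt_const
  have hc : ∀ i, lie h (Y i) p = 0 := fun i => lie_fundField_eq_zero (B := B) hh hinv _ (hY i)
  have e : (fun q => fundField (EG := EG) (G := G) (a q) q : VField EP P)
      = fun q => ∑ i, f i q • Y i q := funext fun q => hsum q (a q)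
  rw [e, mlieBracket_sum_smul_of_commute Finset.univ hf hY hc]
  refine Eq.trans ?_ (hsum p _).symm
  refine Finset.sum_congr rfl fun i _ => ?_
  congr 1
  have := mfderiv_comp_apply p (g := ℓ i) (ℓ i).differentiableAt.mdifferentiableAt ha (h p)
  rw [mfderiv_eq_fderiv, ContinuousLinearMap.fderiv] at this
  exact this

/-! ### Principal connections: horizontal lifts and the horizontal-vertical splitting. -/

namespace Connection

variable (A : B.Connection)

/-- Vertical vectors are fundamental, and the connection form recovers their generator. This gives
injectivity, and surjectivity by correcting any lift vertically. `lift` is defined through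
`inverse`, which is zero on non-invertible maps, so its defining properties rest on this. -/
lemma isInvertible_prod (p : P) :
    ((mfderiv 𝓘(ℝ, EP) 𝓘(ℝ, EM) B.proj p).prod (A.form p)).IsInvertible := by
  set L : EP →L[ℝ] EM × EG := (mfderiv 𝓘(ℝ, EP) 𝓘(ℝ, EM) B.proj p).prod (A.form p)
  have hinj : Function.Injective L := by
    refine (injective_iff_map_eq_zero L).2 fun v hv => ?_
    obtain ⟨z, rfl⟩ := B.exists_eq_fundField (congrArg Prod.fst hv : _ = (0 : EM))
    have : z = 0 := (A.form_fundField z p).symm.trans (congrArg Prod.snd hv)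
    rw [this]
    exact map_zero _
  have hsurj : Function.Surjective L := fun ⟨y, z⟩ => by
    obtain ⟨w, hw⟩ := B.mfderiv_proj_surjective p y
    let z' : LieAlg EG G := (show LieAlg EG G from z) - A.form p w
    let u : EP := fundField z' p
    refine ⟨w + u, Prod.ext ?_ ?_⟩
    · refine (map_add (mfderiv 𝓘(ℝ, EP) 𝓘(ℝ, EM) B.proj p) _ _).trans ?_
      have := B.mfderiv_proj_fundField z' p
      exact (congrArg₂ (· + ·) hw this).trans (add_zero y)
    · refine (map_add (A.form p) _ _).trans ?_
      exact (congrArg (A.form p w + ·) (A.form_fundField z' p)).trans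
        (add_sub_cancel (A.form p w) (show LieAlg EG G from z))
  exact ⟨(LinearEquiv.ofBijective (L : EP →ₗ[ℝ] EM × EG)
    ⟨hinj, hsurj⟩).toContinuousLinearEquiv, rfl⟩

lemma mfderiv_proj_lift (Z : VField EM M) (p : P) :
    mfderiv 𝓘(ℝ, EP) 𝓘(ℝ, EM) B.proj p (A.lift Z p) = Z (B.proj p) :=
  congrArg Prod.fst ((A.isInvertible_prod p).self_apply_inverse (Z (B.proj p), 0))

lemma form_lift (Z : VField EM M) (p : P) : A.form p (A.lift Z p) = 0 :=
  congrArg Prod.snd ((A.isInvertible_prod p).self_apply_inverse (Z (B.proj p), 0))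

lemma lift_eq {Z : VField EM M} {p : P} {v : TangentSpace 𝓘(ℝ, EP) p}
    (h : (mfderiv 𝓘(ℝ, EP) 𝓘(ℝ, EM) B.proj p v : EM) = Z (B.proj p)) (h' : A.form p v = 0) :
    A.lift Z p = v := by
  have := (A.isInvertible_prod p).inverse_apply_self v
  rw [← this, lift]
  congr 1
  exact Prod.ext h.symm h'.symm

lemma Ad_zero (g : G) : Ad g (0 : LieAlg EG G) = 0 := map_zero _

lemma invariant_lift (Z : VField EM M) : B.Invariant (A.lift Z) := fun p g => by
  refine A.lift_eq ?_ ?_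
  · refine (B.mfderiv_proj_ract p g _).trans ((A.mfderiv_proj_lift Z p).trans ?_)
    exact field_congr Z (B.proj_act p g).symm
  · rw [A.equivariant, form_lift, Ad_zero]

lemma form_vert (X : VField EP P) (p : P) : A.form p (A.vert X p) = A.form p (X p) :=
  A.form_fundField _ _

lemma form_hor (X : VField EP P) (p : P) : A.form p (A.hor X p) = 0 := by
  rw [hor, map_sub, form_vert, sub_self]

lemma hor_eq_lift {X : VField EP P} (hX : B.Invariant X) : A.hor X = A.lift (B.push X) := by
  funext p
  refine (A.lift_eq ?_ (A.form_hor X p)).symm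
  have h := map_sub (mfderiv 𝓘(ℝ, EP) 𝓘(ℝ, EM) B.proj p) (X p) (A.vert X p)
  refine h.trans ?_
  have h2 : mfderiv 𝓘(ℝ, EP) 𝓘(ℝ, EM) B.proj p (A.vert X p) = 0 :=
    B.mfderiv_proj_fundField _ _
  rw [h2, sub_zero]
  exact hX.mfderiv_proj p

lemma vert_lift (Z : VField EM M) : A.vert (A.lift Z) = 0 := by
  funext p
  rw [vert, form_lift]
  exact map_zero _

lemma hor_lift (Z : VField EM M) : A.hor (A.lift Z) = A.lift Z := by
  funext p
  rw [hor, vert_lift, Pi.zero_apply, sub_zero]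

lemma hor_add_vert (X : VField EP P) : A.hor X + A.vert X = X := by
  funext p
  exact sub_add_cancel _ _

/-- The vertical part is the difference of `X` and a horizontal lift, both invariant, so no formula
for translates of fundamental fields is required. -/
lemma invariant_vert {X : VField EP P} (hX : B.Invariant X) : B.Invariant (A.vert X) := by
  have : A.vert X = X - A.lift (B.push X) := by
    rw [← A.hor_eq_lift hX]
    exact eq_sub_of_add_eq' (A.hor_add_vert X)
  rw [this]
  exact hX.sub (A.invariant_lift _)

/-- The function `A(X)` with values in the model space of the Lie algebra. -/
def formFun (X : VField EP P) : P → EG := fun q => A.form q (X q)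

lemma mdifferentiableAt_formFun {X : VField EP P} {p : P} (hX : MDiffAt (T% X) p) :
    MDifferentiableAt 𝓘(ℝ, EP) 𝓘(ℝ, EG) (A.formFun X) p :=
  SmoothForm.mdifferentiableAt_apply (F := EG) A.smooth hX

lemma mdifferentiableAt_vert {X : VField EP P} {p : P} (hX : MDiffAt (T% X) p) :
    MDiffAt (T% (A.vert X)) p :=
  B.mdifferentiableAt_fundField (A.mdifferentiableAt_formFun hX)

lemma mdifferentiableAt_hor {X : VField EP P} {p : P} (hX : MDiffAt (T% X) p) :
    MDiffAt (T% (A.hor X)) p :=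
  mdifferentiableAt_sub_section hX (A.mdifferentiableAt_vert hX)

lemma mdifferentiableAt_lift {Z : VField EM M} {p : P} (hZ : MDiffAt (T% Z) (B.proj p)) :
    MDiffAt (T% (A.lift Z)) p := by
  obtain ⟨t, ht, hx⟩ := B.exists_isEquivTriv (B.proj p)
  set T := t.toOpenPartialHomeomorph
  set J := 𝓘(ℝ, EM).prod 𝓘(ℝ, EG)
  -- A local lift of `Z` with zero `G`-component in the trivialization. It is differentiable, and by
  -- uniqueness its horizontal part is the horizontal lift.
  let W : VField EP P := fun q =>
    (mfderiv J 𝓘(ℝ, EP) T.symm (B.proj q, (T q).2) ((Z (B.proj q) : EM), (0 : EG)) : EP)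
  have hW : MDiffAt (T% W) p := by
    have hT : MDifferentiableAt 𝓘(ℝ, EP) 𝓘(ℝ, EG) (fun q => (T q).2) p :=
      (ht.mdifferentiable.mdifferentiableAt (t.mem_source.2 hx)).snd
    have h1 := mdifferentiableAt_tangentBundle_prod
      (hZ.comp p (B.contMDiff_proj.mdifferentiable (by simp) p))
      ((mdifferentiable_zeroSection ℝ (TangentSpace 𝓘(ℝ, EG) : G → Type _) (T p).2).comp p hT)
    have hy : (B.proj p, (T p).2) ∈ T.target := t.mem_target.2 hx
    have h2 := (ht.contMDiffOn_symm.contMDiffOn_tangentMapWithin (m := 1) one_add_one_le_infty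
      T.open_target.uniqueMDiffOn).contMDiffAt
      (x := ⟨(B.proj p, (T p).2), ((Z (B.proj p) : EM), (0 : EG))⟩)
      ((T.open_target.preimage (FiberBundle.continuous_proj _ _)).mem_nhds hy)
    refine ((h2.mdifferentiableAt (by simp)).comp p h1).congr_of_eventuallyEq ?_
    filter_upwards [T.open_source.mem_nhds (t.mem_source.2 hx)] with q hq
    have hq' : B.proj q ∈ t.baseSet := t.mem_source.1 hq
    have hd := mfderivWithin_of_isOpen (I := J) (I' := 𝓘(ℝ, EP)) (f := T.symm) T.open_target
      (t.mem_target.2 hq' : (B.proj q, (T q).2) ∈ T.target)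
    refine (tangentBundle_mk_congr (ht.symm_apply_self hq').symm _).trans ?_
    exact congrArg (fun v : EP => (⟨T.symm (B.proj q, (T q).2), v⟩ : TangentBundle 𝓘(ℝ, EP) P))
      (DFunLike.congr_fun hd.symm _)
  refine (A.mdifferentiableAt_hor hW).congr_of_eventuallyEq ?_
  filter_upwards [T.open_source.mem_nhds (t.mem_source.2 hx)] with q hq
  have hq' : B.proj q ∈ t.baseSet := t.mem_source.1 hq
  have : A.lift Z q = A.hor W q := by
    refine A.lift_eq ?_ (A.form_hor W q)
    have h := map_sub (mfderiv 𝓘(ℝ, EP) 𝓘(ℝ, EM) B.proj q) (W q) (A.vert W q)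
    refine h.trans ?_
    have h2 : mfderiv 𝓘(ℝ, EP) 𝓘(ℝ, EM) B.proj q (A.vert W q) = 0 :=
      B.mfderiv_proj_fundField _ _
    rw [h2, sub_zero]
    exact (mfderiv_apply_congr (ht.symm_apply_self hq').symm _).trans
      (ht.mfderiv_proj_symm (t.mem_target.2 hq') _)
  rw [this]

end Connection
end SmoothPrincipalBundle

/-! ### Tensoriality -/

section Tensorial

variable {E N : Type*} [NormedAddCommGroup E] [NormedSpace ℝ E] [FiniteDimensional ℝ E]
  [TopologicalSpace N] [ChartedSpace E N] [IsManifold 𝓘(ℝ, E) ∞ N]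

/-- Where tensoriality fails, `formOf` is zero by default. The form part of the bracket can
therefore be evaluated only after each summand is shown to be tensorial. -/
lemma formOf_apply {φ : VField E N → N → ℝ} {x : N}
    (h : TensorialAt 𝓘(ℝ, E) E (fun Z => φ Z x) x) {Z : VField E N} (hZ : MDiffAt (T% Z) x) :
    formOf φ x (Z x) = φ Z x := by
  rw [formOf, dif_pos h]
  exact TensorialAt.mkHom_apply h hZ

lemma tensorialAt_add {Φ Ψ : VField E N → ℝ} {x : N} (hΦ : TensorialAt 𝓘(ℝ, E) E Φ x)
    (hΨ : TensorialAt 𝓘(ℝ, E) E Ψ x) : TensorialAt 𝓘(ℝ, E) E (fun Z => Φ Z + Ψ Z) x where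
  smul hf hZ := by simp only [hΦ.smul hf hZ, hΨ.smul hf hZ, smul_add]
  add hZ hZ' := by simp only [hΦ.add hZ hZ', hΨ.add hZ hZ']; ring

lemma tensorialAt_const_mul {Φ : VField E N → ℝ} {x : N} (a : ℝ)
    (hΦ : TensorialAt 𝓘(ℝ, E) E Φ x) : TensorialAt 𝓘(ℝ, E) E (fun Z => a * Φ Z) x where
  smul hf hZ := by simp only [hΦ.smul hf hZ, smul_eq_mul]; ring
  add hZ hZ' := by simp only [hΦ.add hZ hZ']; ring

lemma tensorialAt_sub {Φ Ψ : VField E N → ℝ} {x : N} (hΦ : TensorialAt 𝓘(ℝ, E) E Φ x)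
    (hΨ : TensorialAt 𝓘(ℝ, E) E Ψ x) : TensorialAt 𝓘(ℝ, E) E (fun Z => Φ Z - Ψ Z) x where
  smul hf hZ := by simp only [hΦ.smul hf hZ, hΨ.smul hf hZ, smul_sub]
  add hZ hZ' := by simp only [hΦ.add hZ hZ', hΨ.add hZ hZ']; ring

lemma dirDeriv_mul (X : VField E N) {f g : N → ℝ} {x : N}
    (hf : MDifferentiableAt 𝓘(ℝ, E) 𝓘(ℝ) f x) (hg : MDifferentiableAt 𝓘(ℝ, E) 𝓘(ℝ) g x) :
    dirDeriv X (fun y => f y * g y) x = f x * dirDeriv X g x + dirDeriv X f x * g x := by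
  simp only [dirDeriv, mvfderiv_fun_mul hf hg]
  simp [mul_comm]

lemma dirDeriv_add (X : VField E N) {f g : N → ℝ} {x : N}
    (hf : MDifferentiableAt 𝓘(ℝ, E) 𝓘(ℝ) f x) (hg : MDifferentiableAt 𝓘(ℝ, E) 𝓘(ℝ) g x) :
    dirDeriv X (fun y => f y + g y) x = dirDeriv X f x + dirDeriv X g x := by
  simp only [dirDeriv, mvfderiv_fun_add hf hg]
  rfl

/-- The derivative of `f` from the product rule cancels the one from the Leibniz rule of the
bracket. -/
lemma tensorialAt_lieDerivForm (X : VField E N) {η : OneForm E N} (hη : SmoothForm η) (x : N) :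
    TensorialAt 𝓘(ℝ, E) E (fun Z => lieDerivForm X η Z x) x where
  smul {f Z} hf hZ := by
    have e : (fun y => η y ((f • Z) y)) = fun y => f y * η y (Z y) := by
      funext y; simp
    simp only [lieDerivForm]
    rw [e, dirDeriv_mul X hf (hη.mdifferentiableAt_apply hZ), lie, mlieBracket_smul_right hf hZ,
      map_add, map_smul, map_smul]
    simp only [dirDeriv, smul_eq_mul]
    ring
  add {Z Z'} hZ hZ' := by
    have e : (fun y => η y ((Z + Z') y)) = fun y => η y (Z y) + η y (Z' y) := by
      funext y; simp
    simp only [lieDerivForm]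
    rw [e, dirDeriv_add X (hη.mdifferentiableAt_apply hZ) (hη.mdifferentiableAt_apply hZ'), lie,
      mlieBracket_add_right hZ hZ', map_add]
    ring

lemma tensorialAt_dForm {ξ : OneForm E N} (hξ : SmoothForm ξ) (Y : VField E N) (x : N) :
    TensorialAt 𝓘(ℝ, E) E (fun Z => dForm ξ Y Z x) x := by
  -- The two expressions differ by Z(ξ(Y)), which is linear in `Z` pointwise.
  have h : (fun Z => dForm ξ Y Z x)
      = fun Z => lieDerivForm Y ξ Z x - dirDeriv Z (fun y => ξ y (Y y)) x := by
    funext Z; simp only [dForm, lieDerivForm]; ring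
  rw [h]
  refine tensorialAt_sub (tensorialAt_lieDerivForm Y hξ x) ⟨fun {f Z} _ _ => ?_, fun _ _ => ?_⟩
  · simp [dirDeriv]
  · simp [dirDeriv]

lemma tensorialAt_dualConn
    (nab : CovariantDerivative 𝓘(ℝ, E) E (TangentSpace 𝓘(ℝ, E) : N → Type _))
    (X : VField E N) {ξ : OneForm E N} (hξ : SmoothForm ξ) (x : N) :
    TensorialAt 𝓘(ℝ, E) E
      (fun Z => dirDeriv X (fun y => ξ y (Z y)) x - ξ x (nab Z x (X x))) x where
  smul {f Z} hf hZ := by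
    have e : (fun y => ξ y ((f • Z) y)) = fun y => f y * ξ y (Z y) := by
      funext y; simp
    rw [e, dirDeriv_mul X hf (hξ.mdifferentiableAt_apply hZ),
      nab.isCovariantDerivativeOn.leibniz hZ hf]
    simp [dirDeriv]
    ring
  add {Z Z'} hZ hZ' := by
    have e : (fun y => ξ y ((Z + Z') y)) = fun y => ξ y (Z y) + ξ y (Z' y) := by
      funext y; simp
    rw [e, dirDeriv_add X (hξ.mdifferentiableAt_apply hZ) (hξ.mdifferentiableAt_apply hZ'),
      nab.isCovariantDerivativeOn.add hZ hZ']
    simp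
    ring

lemma tensorialAt_threeForm (H : ThreeForm E N) (x : N) (u v : TangentSpace 𝓘(ℝ, E) x) :
    TensorialAt 𝓘(ℝ, E) E (fun Z => H.toFun x ![u, v, Z x]) x := by
  have e : ∀ w : TangentSpace 𝓘(ℝ, E) x, ![u, v, w] = Function.update ![u, v, 0] 2 w := by
    intro w; funext i; fin_cases i <;> rfl
  constructor
  · intro f Z _ _
    rw [e, e (Z x), Pi.smul_apply', (H.toFun x).map_update_smul]
  · intro Z Z' _ _
    rw [e, e (Z x), e (Z' x), Pi.add_apply, (H.toFun x).map_update_add]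

lemma ThreeForm.map_swap (H : ThreeForm E N) (x : N) (u v w : TangentSpace 𝓘(ℝ, E) x) :
    H.toFun x ![v, u, w] = -H.toFun x ![u, v, w] := by
  have e : ![v, u, w] = ![u, v, w] ∘ Equiv.swap (0 : Fin 3) 1 := by
    funext i; fin_cases i <;> rfl
  rw [e]
  exact (H.toFun x).toAlternatingMap.map_swap _ (by decide)

end Tensorial

/-! ### Brackets on `P` seen through the projection and the connection form. -/

namespace SmoothPrincipalBundle

variable {B : SmoothPrincipalBundle EM EG EP M G P}

lemma mfderiv_proj_lie {X Y : VField EP P} {X' Y' : VField EM M} {p : P}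
    (hX : MDiffAt (T% X) p) (hY : MDiffAt (T% Y) p)
    (hX' : MDiffAt (T% X') (B.proj p)) (hY' : MDiffAt (T% Y') (B.proj p))
    (hXX' : ∀ q, (mfderiv 𝓘(ℝ, EP) 𝓘(ℝ, EM) B.proj q (X q) : EM) = X' (B.proj q))
    (hYY' : ∀ q, (mfderiv 𝓘(ℝ, EP) 𝓘(ℝ, EM) B.proj q (Y q) : EM) = Y' (B.proj q)) :
    mfderiv 𝓘(ℝ, EP) 𝓘(ℝ, EM) B.proj p (lie X Y p) = lie X' Y' (B.proj p) :=
  mfderiv_mlieBracket_of_related (B.contMDiff_proj.contMDiffAt.of_le ENat.LEInfty.out)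
    hX hY hX' hY' (Eventually.of_forall hXX') (Eventually.of_forall hYY')

lemma push_lie {X Y : VField EP P} (hX : B.Invariant X) (hY : B.Invariant Y)
    (hdX : ∀ p, MDiffAt (T% X) p) (hdY : ∀ p, MDiffAt (T% Y) p) (x : M) :
    B.push (lie X Y) x = lie (B.push X) (B.push Y) x :=
  (mfderiv_proj_lie (hdX _) (hdY _) (hX.mdifferentiableAt_push hdX _)
    (hY.mdifferentiableAt_push hdY _) hX.mfderiv_proj hY.mfderiv_proj).trans
    (field_congr (lie (B.push X) (B.push Y)) (B.proj_point x))

namespace Connection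

variable (A : B.Connection)

lemma push_lift (Z : VField EM M) (x : M) : B.push (A.lift Z) x = Z x :=
  (A.mfderiv_proj_lift Z _).trans (field_congr Z (B.proj_point x))

/-- The derivative of the function `A(X)`. -/
def formDeriv (X : VField EP P) (p : P) : TangentSpace 𝓘(ℝ, EP) p →L[ℝ] LieAlg EG G :=
  mvfderiv 𝓘(ℝ, EP) (A.formFun X) p

/-- This is `lie_fundField` with coefficient A(X). The right side sees `h` only through its value at
`p`, which is the source of the tensoriality of ∇^A in its first argument. -/
lemma form_lie_vert {h X : VField EP P} {p : P} (hinv : B.Invariant h) (hh : MDiffAt (T% h) p)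
    (hX : MDiffAt (T% X) p) :
    A.form p (lie h (A.vert X) p) = A.formDeriv X p (h p) := by
  have e : A.vert X = fun q => fundField (EG := EG) (G := G) (A.formFun X q) q := rfl
  rw [e, lie_fundField hinv hh (A.mdifferentiableAt_formFun hX)]
  exact A.form_fundField (A.formDeriv X p (h p)) p

/-- The projection relates the lift to `Z` and a vertical field to zero, so their bracket is
vertical. -/
lemma push_adConn {Z : VField EM M} {X : VField EP P} {x : M} (hZ : MDiffAt (T% Z) x)
    (hX : MDiffAt (T% X) (B.point x)) : B.push (A.adConn Z (A.vert X)) x = 0 := by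
  have hZ' : MDiffAt (T% Z) (B.proj (B.point x)) := by rwa [B.proj_point]
  refine (mfderiv_proj_lie (X' := Z) (Y' := 0) (A.mdifferentiableAt_lift hZ')
    (A.mdifferentiableAt_vert hX) hZ'
    (mdifferentiable_zeroSection ℝ (TangentSpace 𝓘(ℝ, EM) : M → Type _) _)
    (A.mfderiv_proj_lift Z) fun q => B.mfderiv_proj_fundField _ q).trans ?_
  exact congrFun (mlieBracket_zero_right (I := 𝓘(ℝ, EM)) (W := Z)) _

lemma form_curv (X Y : VField EP P) (p : P) :
    A.form p (A.curv X Y p) = -A.form p (lie (A.hor X) (A.hor Y) p) := by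
  rw [curv, Pi.neg_apply, map_neg, form_vert]

/-- `A[X, Y]` in terms of the horizontal and vertical parts of `X` and `Y`. -/
lemma form_lie {X Y : VField EP P} {p : P} (hdX : MDiffAt (T% X) p)
    (hdY : MDiffAt (T% Y) p) :
    A.form p (lie X Y p) = A.form p (lie (A.hor X) (A.hor Y) p)
      + A.form p (lie (A.hor X) (A.vert Y) p) - A.form p (lie (A.hor Y) (A.vert X) p)
      + A.form p (lie (A.vert X) (A.vert Y) p) := by
  have h1 := A.mdifferentiableAt_hor hdX
  have h2 := A.mdifferentiableAt_vert hdX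
  have h3 := A.mdifferentiableAt_hor hdY
  have h4 := A.mdifferentiableAt_vert hdY
  conv_lhs => rw [← A.hor_add_vert X, ← A.hor_add_vert Y]
  have e : lie (A.hor X + A.vert X) (A.hor Y + A.vert Y) p
      = (lie (A.hor X) (A.hor Y) p + lie (A.hor X) (A.vert Y) p)
        + (-lie (A.hor Y) (A.vert X) p + lie (A.vert X) (A.vert Y) p) := by
    rw [lie, mlieBracket_add_left h1 h2, mlieBracket_add_right h3 h4, mlieBracket_add_right h3 h4,
      mlieBracket_swap_apply (V := A.vert X) (W := A.hor Y)]
  rw [e, map_add, map_add, map_add, map_neg]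
  abel

lemma lift_smul (f : M → ℝ) (Z : VField EM M) :
    A.lift (f • Z) = (f ∘ B.proj) • A.lift Z := by
  funext p
  refine A.lift_eq ?_ ?_
  · refine (map_smul (mfderiv 𝓘(ℝ, EP) 𝓘(ℝ, EM) B.proj p) _ _).trans ?_
    rw [A.mfderiv_proj_lift]
    rfl
  · rw [Pi.smul_apply', map_smul, A.form_lift, smul_zero]

lemma lift_add (Z Z' : VField EM M) : A.lift (Z + Z') = A.lift Z + A.lift Z' := by
  funext p
  refine A.lift_eq ?_ ?_
  · refine (map_add (mfderiv 𝓘(ℝ, EP) 𝓘(ℝ, EM) B.proj p) _ _).trans ?_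
    rw [A.mfderiv_proj_lift, A.mfderiv_proj_lift]
    rfl
  · rw [Pi.add_apply, map_add, A.form_lift, A.form_lift, add_zero]

/-- Tensoriality of `Z ↦ c(∇^A_Z (A X), ·)`. -/
lemma tensorialAt_adConn {X : VField EP P} {x : M} (hX : MDiffAt (T% X) (B.point x))
    (ℓ : LieAlg EG G →ₗ[ℝ] ℝ) :
    TensorialAt 𝓘(ℝ, EM) EM
      (fun Z => ℓ (A.form (B.point x) (A.adConn Z (A.vert X) (B.point x)))) x := by
  have key : ∀ {Z : VField EM M}, MDiffAt (T% Z) x →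
      A.form (B.point x) (A.adConn Z (A.vert X) (B.point x))
        = A.formDeriv X (B.point x) (A.lift Z (B.point x)) := fun hZ =>
    A.form_lie_vert (A.invariant_lift _)
      (A.mdifferentiableAt_lift (by rwa [B.proj_point])) hX
  constructor
  · intro f Z hf hZ
    rw [key (hf.smul_section hZ), key hZ, A.lift_smul, Pi.smul_apply', map_smul,
      Function.comp_apply, B.proj_point]
    exact map_smul ℓ _ _
  · intro Z Z' hZ hZ'
    rw [key (mdifferentiableAt_add_section hZ hZ'), key hZ, key hZ', A.lift_add, Pi.add_apply,
      map_add]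
    exact map_add ℓ _ _

/-- Tensoriality of `Z ↦ c(F(X, Z), ·)`. -/
lemma tensorialAt_curv (X : VField EP P) (x : M) (ℓ : LieAlg EG G →ₗ[ℝ] ℝ) :
    TensorialAt 𝓘(ℝ, EM) EM
      (fun Z => ℓ (A.form (B.point x) (A.curv X (A.lift Z) (B.point x)))) x := by
  have hl : ∀ {Z : VField EM M}, MDiffAt (T% Z) x → MDiffAt (T% (A.lift Z)) (B.point x) :=
    fun hZ => A.mdifferentiableAt_lift (by rwa [B.proj_point])
  constructor
  · intro f Z hf hZ
    have hf' : MDifferentiableAt 𝓘(ℝ, EP) 𝓘(ℝ) (f ∘ B.proj) (B.point x) :=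
      MDifferentiableAt.comp (B.point x) (by rwa [B.proj_point])
        (B.contMDiff_proj.mdifferentiable (by simp) _)
    -- The Leibniz term containing the derivative of `f` is a multiple of `A.lift Z`, which the
    -- connection form kills.
    rw [form_curv, form_curv, hor_lift, hor_lift, A.lift_smul, lie,
      mlieBracket_smul_right hf' (hl hZ), map_add, map_smul, map_smul, A.form_lift, smul_zero,
      zero_add, Function.comp_apply, B.proj_point, ← smul_neg, map_smul]
  · intro Z Z' hZ hZ'
    rw [form_curv, form_curv, form_curv, hor_lift, hor_lift, hor_lift, A.lift_add, lie,
      mlieBracket_add_right (hl hZ) (hl hZ'), map_add, neg_add, map_add]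

lemma formFun_ract {X : VField EP P} (hX : B.Invariant X) (p : P) (g : G) :
    A.formFun X (ract p g) = Ad (EG := EG) g⁻¹ (A.formFun X p) := by
  rw [formFun, hX p g, A.equivariant]
  rfl

/-- `c(A Y, A Z)` is constant along the fibres. -/
lemma metric_mvfderiv_formFun {c : LinearMap.BilinForm ℝ (LieAlg EG G)} (hc : IsInvariantMetric c)
    {Y Z : VField EP P} (hY : B.Invariant Y) (hZ : B.Invariant Z) {p : P}
    (hdY : MDiffAt (T% Y) p) (hdZ : MDiffAt (T% Z) p) (z : LieAlg EG G) :
    c (A.formDeriv Y p (fundField z p)) (A.form p (Z p))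
      + c (A.form p (Y p)) (A.formDeriv Z p (fundField z p)) = 0 := by
  let C : EG →L[ℝ] EG →L[ℝ] ℝ := LinearMap.toContinuousBilinearMap (E := EG) (F := EG) (G := ℝ) c
  let Φ : EG × EG → ℝ := fun u => C u.1 u.2
  let F : P → EG × EG := fun q => (A.formFun Y q, A.formFun Z q)
  have hp : ract p (1 : G) = p := by simp [ract]
  have hΦ : HasFDerivAt Φ (C.deriv₂ (F p)) (F p) := C.isBoundedBilinearMap.hasFDerivAt (F p)
  have hF : HasMFDerivAt 𝓘(ℝ, EP) 𝓘(ℝ, EG × EG) F p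
      ((mfderiv 𝓘(ℝ, EP) 𝓘(ℝ, EG) (A.formFun Y) p).prod
        (mfderiv 𝓘(ℝ, EP) 𝓘(ℝ, EG) (A.formFun Z) p)) :=
    ⟨(A.mdifferentiableAt_formFun hdY).continuousAt.prodMk
      (A.mdifferentiableAt_formFun hdZ).continuousAt,
      (A.mdifferentiableAt_formFun hdY).hasMFDerivAt.2.prodMk
        (A.mdifferentiableAt_formFun hdZ).hasMFDerivAt.2⟩
  have h1 := HasMFDerivAt.comp p hΦ.hasMFDerivAt hF
  have h2 := mfderiv_comp_apply (1 : G) (g := Φ ∘ F) (f := fun g : G => ract p g)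
    (by rw [hp]; exact h1.mdifferentiableAt)
    ((B.contMDiff_ract_right p).mdifferentiable (by simp) 1) z
  -- Along an orbit both arguments are moved by the same Ad(g⁻¹), so the composite is constant and
  -- its derivative at 1 vanishes.
  have h3 : (Φ ∘ F) ∘ (fun g : G => ract p g) = fun _ => Φ (F p) := by
    funext g
    have := hc.invariant g⁻¹ (A.formFun Y p) (A.formFun Z p)
    rw [← A.formFun_ract hY, ← A.formFun_ract hZ] at this
    exact this
  rw [h3, mfderiv_const] at h2
  have h4 := (mfderiv_apply_congr hp _).symm.trans h2.symm
  rw [h1.mfderiv] at h4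
  exact (add_comm _ _).trans h4

/-- Infinitesimal Ad-invariance without the bracket of the Lie algebra: AY is itself an invariant
field, so the brackets with it are derivatives along it of A(X) and A(Z), while c(AX, AZ) is
constant on fibres. -/
lemma metric_form_lie_vert {c : LinearMap.BilinForm ℝ (LieAlg EG G)} (hc : IsInvariantMetric c)
    {X Y Z : VField EP P} (hX : B.Invariant X) (hY : B.Invariant Y) (hZ : B.Invariant Z) {p : P}
    (hdX : MDiffAt (T% X) p) (hdY : MDiffAt (T% Y) p) (hdZ : MDiffAt (T% Z) p) :
    c (A.form p (lie (A.vert X) (A.vert Y) p)) (A.form p (Z p))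
      = c (A.form p (X p)) (A.form p (lie (A.vert Y) (A.vert Z) p)) := by
  have e : lie (A.vert X) (A.vert Y) p = -lie (A.vert Y) (A.vert X) p := mlieBracket_swap_apply
  have h := A.metric_mvfderiv_formFun hc hX hZ hdX hdZ (A.form p (Y p))
  have h1 := A.form_lie_vert (A.invariant_vert hY) (A.mdifferentiableAt_vert hdY) hdX
  have h2 := A.form_lie_vert (A.invariant_vert hY) (A.mdifferentiableAt_vert hdY) hdZ
  rw [e, map_neg, h1, h2, map_neg, LinearMap.neg_apply]
  exact neg_eq_of_add_eq_zero_right h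

end Connection
end SmoothPrincipalBundle

namespace CourantData

open SmoothPrincipalBundle

variable (𝓔 : CourantData EM EG EP M G P)

/-! ### The pairing -/

/-- The value of the connection form on a vector field, at the chosen point of a fibre. -/
def formAt (X : VField EP P) (x : M) : LieAlg EG G := 𝓔.A.form (𝓔.B.point x) (X (𝓔.B.point x))

lemma pairing_eq (e₁ e₂ : PreSection EM EP M P) (x : M) :
    𝓔.pairing e₁ e₂ x = (1 / 2) * (e₂.2 x (𝓔.anchor e₁ x) + e₁.2 x (𝓔.anchor e₂ x))
      + 𝓔.c (𝓔.formAt e₁.1 x) (𝓔.formAt e₂.1 x) := by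
  rw [pairing, cM, Connection.form_vert, Connection.form_vert]
  rfl

lemma anchor_add (e e' : PreSection EM EP M P) : 𝓔.anchor (e + e') = 𝓔.anchor e + 𝓔.anchor e' :=
  funext fun x =>
    map_add (mfderiv 𝓘(ℝ, EP) 𝓘(ℝ, EM) 𝓔.B.proj (𝓔.B.point x)) (e.1 _) (e'.1 _)

lemma anchor_smul (a : ℝ) (e : PreSection EM EP M P) : 𝓔.anchor (a • e) = a • 𝓔.anchor e :=
  funext fun x => map_smul (mfderiv 𝓘(ℝ, EP) 𝓘(ℝ, EM) 𝓔.B.proj (𝓔.B.point x)) a (e.1 _)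

lemma pairing_add_left (e e' e₃ : PreSection EM EP M P) (x : M) :
    𝓔.pairing (e + e') e₃ x = 𝓔.pairing e e₃ x + 𝓔.pairing e' e₃ x := by
  have h : 𝓔.formAt (e + e').1 x = 𝓔.formAt e.1 x + 𝓔.formAt e'.1 x :=
    map_add (𝓔.A.form (𝓔.B.point x)) (e.1 _) (e'.1 _)
  rw [pairing_eq, pairing_eq, pairing_eq, h, anchor_add, Prod.snd_add, Pi.add_apply, Pi.add_apply,
    map_add, map_add, LinearMap.add_apply, add_apply]
  ring

lemma pairing_smul_left (a : ℝ) (e e₃ : PreSection EM EP M P) (x : M) :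
    𝓔.pairing (a • e) e₃ x = a * 𝓔.pairing e e₃ x := by
  have h : 𝓔.formAt (a • e).1 x = a • 𝓔.formAt e.1 x :=
    map_smul (𝓔.A.form (𝓔.B.point x)) a (e.1 _)
  rw [pairing_eq, pairing_eq, h, anchor_smul, Prod.smul_snd, Pi.smul_apply, Pi.smul_apply,
    map_smul, map_smul, LinearMap.smul_apply, smul_apply]
  simp only [smul_eq_mul]
  ring

lemma pairing_sub_left (e e' e₃ : PreSection EM EP M P) (x : M) :
    𝓔.pairing (e - e') e₃ x = 𝓔.pairing e e₃ x - 𝓔.pairing e' e₃ x := by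
  have h := 𝓔.pairing_add_left (e - e') e' e₃ x
  rw [sub_add_cancel] at h
  exact eq_sub_of_add_eq h.symm

lemma pairing_comm (e₁ e₂ : PreSection EM EP M P) (x : M) :
    𝓔.pairing e₁ e₂ x = 𝓔.pairing e₂ e₁ x := by
  rw [pairing_eq, pairing_eq, 𝓔.metric.symm]
  ring

/-! ### Sections -/

variable {𝓔} {e e₁ e₂ e₃ : PreSection EM EP M P}

lemma IsSection.invariant (he : 𝓔.IsSection e) : 𝓔.B.Invariant e.1 := he.1.2

lemma IsSection.mdifferentiableAt (he : 𝓔.IsSection e) (p : P) : MDiffAt (T% e.1) p :=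
  SmoothField.mdifferentiableAt he.1.1 p

lemma IsSection.mdifferentiableAt_anchor (he : 𝓔.IsSection e) (x : M) :
    MDiffAt (T% (𝓔.anchor e)) x :=
  he.invariant.mdifferentiableAt_push he.mdifferentiableAt x

lemma IsSection.lift_anchor (he : 𝓔.IsSection e) : 𝓔.A.lift (𝓔.anchor e) = 𝓔.A.hor e.1 :=
  (𝓔.A.hor_eq_lift he.invariant).symm

lemma formAt_lift (Z : VField EM M) (x : M) : 𝓔.formAt (𝓔.A.lift Z) x = 0 := 𝓔.A.form_lift _ _

lemma pairing_splitting (Z : VField EM M) (e : PreSection EM EP M P) (x : M) :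
    𝓔.pairing (𝓔.splitting Z) e x = (1 / 2) * e.2 x (Z x) := by
  have h : 𝓔.anchor (𝓔.splitting Z) x = Z x := 𝓔.A.push_lift Z x
  have h2 : 𝓔.formAt (𝓔.splitting Z).1 x = 0 := formAt_lift Z x
  have h3 : (𝓔.splitting Z).2 x = 0 := rfl
  rw [pairing_eq, h, h2, h3, map_zero]
  simp

/-- `∇^A_{π e₁}(A e₂)` in terms of the derivative of the connection form. -/
lemma formAt_adConn (h₁ : 𝓔.IsSection e₁) (x : M) :
    𝓔.formAt (𝓔.A.adConn (𝓔.anchor e₁) (𝓔.A.vert e₂.1)) x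
      = 𝓔.formAt (lie (𝓔.A.hor e₁.1) (𝓔.A.vert e₂.1)) x := by
  rw [Connection.adConn, h₁.lift_anchor]

/-! ### Expansion of the connection, the bracket and the torsion. -/

lemma pairing_nablaE (nab : CovariantDerivative 𝓘(ℝ, EM) EM (TangentSpace 𝓘(ℝ, EM) : M → Type _))
    (h₁ : 𝓔.IsSection e₁) (h₂ : 𝓔.IsSection e₂) (h₃ : 𝓔.IsSection e₃) (x : M) :
    𝓔.pairing (𝓔.nablaE nab (𝓔.anchor e₁) e₂) e₃ x
      = (1 / 2) * (e₃.2 x (nab (𝓔.anchor e₂) x (𝓔.anchor e₁ x))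
          + (dirDeriv (𝓔.anchor e₁) (fun y => e₂.2 y (𝓔.anchor e₃ y)) x
            - e₂.2 x (nab (𝓔.anchor e₃) x (𝓔.anchor e₁ x))))
        + 𝓔.c (𝓔.formAt (lie (𝓔.A.hor e₁.1) (𝓔.A.vert e₂.1)) x) (𝓔.formAt e₃.1 x) := by
  have ha : 𝓔.anchor (𝓔.nablaE nab (𝓔.anchor e₁) e₂) x
      = nab (𝓔.anchor e₂) x (𝓔.anchor e₁ x) := by
    refine (map_add (mfderiv 𝓘(ℝ, EP) 𝓘(ℝ, EM) 𝓔.B.proj (𝓔.B.point x)) _ _).trans ?_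
    refine (congrArg₂ (fun u v : EM => u + v) (𝓔.A.push_lift _ x)
      (𝓔.A.push_adConn (h₁.mdifferentiableAt_anchor x) (h₂.mdifferentiableAt _))).trans ?_
    exact add_zero (M := EM) _
  have hf : 𝓔.formAt (𝓔.nablaE nab (𝓔.anchor e₁) e₂).1 x
      = 𝓔.formAt (lie (𝓔.A.hor e₁.1) (𝓔.A.vert e₂.1)) x := by
    refine (map_add (𝓔.A.form (𝓔.B.point x)) _ _).trans ?_
    rw [𝓔.A.form_lift, zero_add]
    exact formAt_adConn h₁ x
  have hd : (𝓔.nablaE nab (𝓔.anchor e₁) e₂).2 x (𝓔.anchor e₃ x)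
      = dirDeriv (𝓔.anchor e₁) (fun y => e₂.2 y (𝓔.anchor e₃ y)) x
        - e₂.2 x (nab (𝓔.anchor e₃) x (𝓔.anchor e₁ x)) :=
    formOf_apply (tensorialAt_dualConn nab _ h₂.2 x) (h₃.mdifferentiableAt_anchor x)
  rw [pairing_eq, ha, hf, hd]

lemma pairing_dorfman (h₁ : 𝓔.IsSection e₁) (h₂ : 𝓔.IsSection e₂) (h₃ : 𝓔.IsSection e₃) (x : M) :
    𝓔.pairing (𝓔.dorfman e₁ e₂) e₃ x
      = (1 / 2) * (e₃.2 x (lie (𝓔.anchor e₁) (𝓔.anchor e₂) x)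
          + (lieDerivForm (𝓔.anchor e₁) e₂.2 (𝓔.anchor e₃) x
            - dForm e₁.2 (𝓔.anchor e₂) (𝓔.anchor e₃) x + 𝓔.pullH e₁ e₂ e₃ x
            + 2 * 𝓔.c (𝓔.formAt (lie (𝓔.A.hor e₃.1) (𝓔.A.vert e₁.1)) x) (𝓔.formAt e₂.1 x)
            - 2 * 𝓔.c (𝓔.formAt (lie (𝓔.A.hor e₁.1) (𝓔.A.hor e₃.1)) x) (𝓔.formAt e₂.1 x)
            + 2 * 𝓔.c (𝓔.formAt (lie (𝓔.A.hor e₂.1) (𝓔.A.hor e₃.1)) x) (𝓔.formAt e₁.1 x)))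
        + 𝓔.c (𝓔.formAt (lie (𝓔.A.hor e₁.1) (𝓔.A.hor e₂.1)) x
            + 𝓔.formAt (lie (𝓔.A.hor e₁.1) (𝓔.A.vert e₂.1)) x
            - 𝓔.formAt (lie (𝓔.A.hor e₂.1) (𝓔.A.vert e₁.1)) x
            + 𝓔.formAt (lie (𝓔.A.vert e₁.1) (𝓔.A.vert e₂.1)) x) (𝓔.formAt e₃.1 x) := by
  have ha : 𝓔.anchor (𝓔.dorfman e₁ e₂) x = lie (𝓔.anchor e₁) (𝓔.anchor e₂) x :=
    push_lie h₁.invariant h₂.invariant h₁.mdifferentiableAt h₂.mdifferentiableAt x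
  have hf := 𝓔.A.form_lie (h₁.mdifferentiableAt (𝓔.B.point x)) (h₂.mdifferentiableAt _)
  have hl : ∀ e e' : PreSection EM EP M P, 𝓔.IsSection e' →
      𝓔.A.form (𝓔.B.point x) (𝓔.A.curv e.1 (𝓔.A.lift (𝓔.anchor e')) (𝓔.B.point x))
        = -𝓔.formAt (lie (𝓔.A.hor e.1) (𝓔.A.hor e'.1)) x := fun e e' he' => by
    rw [𝓔.A.form_curv, 𝓔.A.hor_lift, he'.lift_anchor]
    rfl
  have hv : ∀ e : PreSection EM EP M P, 𝓔.A.form (𝓔.B.point x) (𝓔.A.vert e.1 (𝓔.B.point x))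
      = 𝓔.formAt e.1 x := fun e => 𝓔.A.form_vert _ _
  -- The nesting follows the summands in the definition of `dorfman`; `c.flip` fixes the second
  -- argument of the form.
  have ht := tensorialAt_sub (tensorialAt_add (tensorialAt_add (tensorialAt_add
    (tensorialAt_sub (tensorialAt_lieDerivForm (𝓔.anchor e₁) h₂.2 x)
      (tensorialAt_dForm h₁.2 (𝓔.anchor e₂) x))
    (tensorialAt_threeForm 𝓔.H x (𝓔.anchor e₁ x) (𝓔.anchor e₂ x)))
    (tensorialAt_const_mul 2 (𝓔.A.tensorialAt_adConn (h₁.mdifferentiableAt (𝓔.B.point x))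
      (𝓔.c.flip (𝓔.formAt (𝓔.A.vert e₂.1) x)))))
    (tensorialAt_const_mul 2 (𝓔.A.tensorialAt_curv e₁.1 x (𝓔.c.flip (𝓔.formAt (𝓔.A.vert e₂.1) x)))))
    (tensorialAt_const_mul 2 (𝓔.A.tensorialAt_curv e₂.1 x (𝓔.c.flip (𝓔.formAt (𝓔.A.vert e₁.1) x))))
  have hd : (𝓔.dorfman e₁ e₂).2 x (𝓔.anchor e₃ x) = _ :=
    formOf_apply ht (h₃.mdifferentiableAt_anchor x)
  simp only [cM] at hd
  have hc : 𝓔.A.form (𝓔.B.point x)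
      (𝓔.A.adConn (𝓔.anchor e₃) (𝓔.A.vert e₁.1) (𝓔.B.point x)) =
      𝓔.formAt (lie (𝓔.A.hor e₃.1) (𝓔.A.vert e₁.1)) x := formAt_adConn h₃ x
  have hf' : 𝓔.formAt (𝓔.dorfman e₁ e₂).1 x = _ := hf
  rw [pairing_eq, ha, hd, hf', hc, hl e₁ e₃ h₃, hl e₂ e₃ h₃, hv, hv, map_neg, map_neg]
  simp only [LinearMap.neg_apply, pullH]
  simp only [formAt]
  ring

lemma pullH_swap (e₁ e₂ e₃ : PreSection EM EP M P) (x : M) :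
    𝓔.pullH e₂ e₁ e₃ x = -𝓔.pullH e₁ e₂ e₃ x :=
  𝓔.H.map_swap x _ _ _

lemma pullCS_eq (e₁ e₂ e₃ : PreSection EM EP M P) (x : M) :
    𝓔.pullCS e₁ e₂ e₃ x
      = -𝓔.c (𝓔.formAt e₁.1 x) (𝓔.formAt (lie (𝓔.A.vert e₂.1) (𝓔.A.vert e₃.1)) x)
        - 𝓔.c (𝓔.formAt (lie (𝓔.A.hor e₁.1) (𝓔.A.hor e₂.1)) x) (𝓔.formAt e₃.1 x)
        + 𝓔.c (𝓔.formAt (lie (𝓔.A.hor e₁.1) (𝓔.A.hor e₃.1)) x) (𝓔.formAt e₂.1 x)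
        - 𝓔.c (𝓔.formAt (lie (𝓔.A.hor e₂.1) (𝓔.A.hor e₃.1)) x) (𝓔.formAt e₁.1 x) := by
  have hv : ∀ e : PreSection EM EP M P, 𝓔.A.form (𝓔.B.point x) (𝓔.A.vert e.1 (𝓔.B.point x))
      = 𝓔.formAt e.1 x := fun e => 𝓔.A.form_vert _ _
  simp only [pullCS, CS, cM, piQ, hv, Connection.form_curv, map_neg, LinearMap.neg_apply]
  simp only [formAt]
  ring

lemma formAt_lie_swap (X Y : VField EP P) (x : M) :
    𝓔.formAt (lie Y X) x = -𝓔.formAt (lie X Y) x := by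
  have h : lie Y X (𝓔.B.point x) = -lie X Y (𝓔.B.point x) := mlieBracket_swap_apply
  rw [formAt, h, map_neg]
  rfl

/-- The generalized torsion of `∇^E + χ`. -/
theorem GenConnection.torsion_eq
    (nab : CovariantDerivative 𝓘(ℝ, EM) EM (TangentSpace 𝓘(ℝ, EM) : M → Type _))
    (χ : 𝓔.OrthForm) (D : 𝓔.GenConnection)
    (hD : ∀ e s, 𝓔.IsSection e → 𝓔.IsSection s →
      D.toFun e s = 𝓔.nablaE nab (𝓔.anchor e) s + χ.toFun e s)
    (h₁ : 𝓔.IsSection e₁) (h₂ : 𝓔.IsSection e₂) (h₃ : 𝓔.IsSection e₃) (x : M) :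
    D.torsion e₁ e₂ e₃ x
      = -(1 / 2) * 𝓔.pullH e₁ e₂ e₃ x + 𝓔.pullCS e₁ e₂ e₃ x
        + 𝓔.sigmaTorsion nab e₁ e₂ e₃ x + χ.sigma e₁ e₂ e₃ x := by
  have hT : ∀ {e e' : PreSection EM EP M P}, 𝓔.IsSection e → 𝓔.IsSection e' →
      ∀ ξ : TangentSpace 𝓘(ℝ, EM) x →L[ℝ] ℝ,
      ξ (nab.torsion x (𝓔.anchor e x) (𝓔.anchor e' x))
        = ξ (nab (𝓔.anchor e') x (𝓔.anchor e x)) - ξ (nab (𝓔.anchor e) x (𝓔.anchor e' x))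
          - ξ (lie (𝓔.anchor e) (𝓔.anchor e') x) := fun he he' ξ => by
    rw [nab.torsion_apply (he.mdifferentiableAt_anchor x) (he'.mdifferentiableAt_anchor x),
      map_sub, map_sub]
  have hl : ∀ (X Y : VField EM M) (ξ : TangentSpace 𝓘(ℝ, EM) x →L[ℝ] ℝ),
      ξ (lie Y X x) = -ξ (lie X Y x) := fun X Y ξ => by
    rw [lie, VectorField.mlieBracket_swap_apply, map_neg]
  have hχ := χ.skew e₃ e₁ e₂ h₃ h₁ h₂ x
  have hc := 𝓔.A.metric_form_lie_vert 𝓔.metric h₁.invariant h₂.invariant h₃.invariant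
    (h₁.mdifferentiableAt (𝓔.B.point x)) (h₂.mdifferentiableAt _) (h₃.mdifferentiableAt _)
  rw [pairing_comm _ e₁] at hχ
  simp only [GenConnection.torsion, OrthForm.sigma, sigmaTorsion, pullTorsion, pairing_splitting,
    skewBracket, pairing_sub_left, pairing_smul_left, hD _ _ h₁ h₂, hD _ _ h₂ h₁, hD _ _ h₃ h₁,
    hD _ _ h₃ h₂, pairing_add_left, pairing_nablaE nab h₁ h₂ h₃, pairing_nablaE nab h₂ h₁ h₃,
    pairing_nablaE nab h₃ h₁ h₂, pairing_nablaE nab h₃ h₂ h₁, pairing_dorfman h₁ h₂ h₃,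
    pairing_dorfman h₂ h₁ h₃, pullCS_eq, hT h₁ h₂, hT h₁ h₃, hT h₂ h₃]
  -- Antisymmetry expresses the terms of [e₂, e₁] through the same quantities as those of [e₁, e₂].
  rw [pullH_swap e₁ e₂ e₃, formAt_lie_swap (𝓔.A.hor e₁.1) (𝓔.A.hor e₂.1),
    formAt_lie_swap (𝓔.A.vert e₁.1) (𝓔.A.vert e₂.1), hl (𝓔.anchor e₁) (𝓔.anchor e₂)]
  simp only [lieDerivForm, dForm, map_add, map_sub, map_neg, LinearMap.add_apply,
    LinearMap.sub_apply, LinearMap.neg_apply]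
  simp only [formAt] at hc ⊢
  -- `hc` converts -c([Ae₁, Ae₂], Ae₃) into the cubic term of CS(A). Half of `hχ` accounts for the
  -- difference between the half-difference of χ_{e₃} terms and ⟨χ_{e₃}e₁, e₂⟩. All other terms
  -- cancel linearly.
  linear_combination (-1) * hc + (-1 / 2) * hχ

end CourantData

end HeteroticCourant

end

theorem mainTheorem10 {EM EG EP M G P : Type*}
    [NormedAddCommGroup EM] [NormedSpace ℝ EM] [FiniteDimensional ℝ EM]
    [NormedAddCommGroup EG] [NormedSpace ℝ EG] [FiniteDimensional ℝ EG]
    [NormedAddCommGroup EP] [NormedSpace ℝ EP] [FiniteDimensional ℝ EP]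
    [TopologicalSpace M] [T2Space M] [SecondCountableTopology M]
    [ChartedSpace EM M] [IsManifold 𝓘(ℝ, EM) ∞ M]
    [TopologicalSpace G] [ChartedSpace EG G] [Group G] [LieGroup 𝓘(ℝ, EG) ∞ G]
    [TopologicalSpace P] [ChartedSpace EP P] [IsManifold 𝓘(ℝ, EP) ∞ P]
    [MulAction Gᵐᵒᵖ P]
    (𝓔 : HeteroticCourant.CourantData EM EG EP M G P)
    (nab : CovariantDerivative 𝓘(ℝ, EM) EM (TangentSpace 𝓘(ℝ, EM) : M → Type _))
    [CovariantDerivative.ContMDiffCovariantDerivative nab ∞]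
    (χ : 𝓔.OrthForm) (D : 𝓔.GenConnection)
    (hD : ∀ e s, 𝓔.IsSection e → 𝓔.IsSection s →
      D.toFun e s = 𝓔.nablaE nab (𝓔.anchor e) s + χ.toFun e s) :
    ∀ e₁ e₂ e₃, 𝓔.IsSection e₁ → 𝓔.IsSection e₂ → 𝓔.IsSection e₃ → ∀ x : M,
      D.torsion e₁ e₂ e₃ x
        = -(1 / 2) * 𝓔.pullH e₁ e₂ e₃ x + 𝓔.pullCS e₁ e₂ e₃ x
          + 𝓔.sigmaTorsion nab e₁ e₂ e₃ x + χ.sigma e₁ e₂ e₃ x := by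
  exact fun _ _ _ h₁ h₂ h₃ x => D.torsion_eq nab χ hD h₁ h₂ h₃ x
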